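/- **Setting.** Let $d,d_0,N_0,M_0$ be integers, $\Delta>0$, $\lambda>0$. Let $f_0$ be a bounded probability density on $\mathbb R^d$ with $\int\|x\|^q f_0(x)\,dx<\infty$ for all $q>0$; let $\sigma:\mathbb R^d\to\mathbb R^{d\times d}$ be measurable with $a=\sigma\sigma^\top$ invertible everywhere; let $\rho(\cdot\mid x)$ be a probability density on $\mathbb R^{d_0}$ for each $x\in\mathbb R^d$, jointly measurable; let $n_1,\dots,n_{M_0}\in\{0,\dots,N_0\}$ and let $y=(y_1,\dots,y_{M_0})$, $y_m\in\mathbb R^{d_0}$, be the observed data. Let $\mathcal H$ be a reproducing kernel Hilbert space of functions $\mathbb R^d\to\mathbb R^d$ with matrix-valued kernel $K$. For $b\in\mathcal H$ and $x=(x_0,\dots,x_{N_0})\in(\mathbb R^d)^{N_0+1}$ put $$f_X(x\mid b)=f_0(x_0)\prod_{n=1}^{N_0}\mathcal N_d\big(x_n\mid x_{n-1}+b(x_{n-1})\Delta,\;a(x_{n-1})\Delta\big),\qquad f_Y(y\mid b)=\int f_X(x\mid b)\prod_{m=1}^{M_0}\rho(y_m\mid x_{n_m})\,dx,$$ where $\mathcal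 N_d(\cdot\mid m,S)$ is the normal density with mean $m$ and covariance $S$. Assume $f_Y(y\mid b)>0$ for every $b\in\mathcal H$. The filtering distribution $\pi_b$ is the probability measure with density $f_X(x\mid b)\prod_m\rho(y_m\mid x_{n_m})/f_Y(y\mid b)$. The loss (penalized negative log-likelihood) is $\mathcal L(b)=-\ln f_Y(y\mid b)+\lambda\|b\|_{\mathcal H}^2$. For a probability measure $\mu$ on $(\mathbb R^d)^{N_0+1}$ let $$\mathcal R(b,\mu)=-\int\ln f_X(x\mid b)\,\mu(dx)+\lambda\|b\|_{\mathcal H}^2,$$ let the M-step map $\Phi(\mu)$ be the unique minimizer of $\mathcal R(\cdot,\mu)$ over $\mathcal H$, when there is one, and let $\mathcal S=\{b\in\mathcal H: b=\Phi(\pi_b)\}$ be its stationary set. **Assumptions.** For some constants $C_\sigma,C_a,C_K,B\ge 0$ and exponents $s,\alpha,\kappa\ge0$: (a) if $b,\tilde b\in\mathcal H$ and $f_X(x\mid b)=f_X(x\mid\tilde b)$ for all $x$, then $b=\tilde b$; (b) $K$ is continuous in each argument, $u\mapsto K(u,u)$ is continuous, and $\|K(u,u)\|_{\rm op}\le C_K(1+\|u\|^{\kappa})$;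 (c) $\|\sigma(u)\|_{\rm op}\le C_\sigma(1+\|u\|^{s})$; (d) $\|a(u)^{-1}\|_{\rm op}\le C_a(1+\|u\|^{\alpha})$; (e) $\rho(u\mid x)\le B$ for all $u,x$. **Theorem.** For every $b\in\mathcal H$ let $(\hat\pi^{(L)}_b)_{L\ge1}$ be probability measures on $(\mathbb R^d)^{N_0+1}$ such that the relative entropy $\mathrm{KL}\big(\hat\pi^{(L)}_b\,\|\,\pi_b\big)\to0$ as $L\to\infty$, and such that, for some $p>2\max(\kappa,1)+\alpha$ and $C$ (which may depend on $b$), $\int\|x_n\|^p\,\hat\pi^{(L)}_b(dx)\le C$ for all $0\le n\le N_0$ and all $L\ge1$. Then for every $b_0\in\mathcal H$ there are positive integers $L_0,L_1,\dots$ such that the approximate EM sequence $$\hat b_0=b_0,\qquad \hat b_k=\Phi\big(\hat\pi^{(L_{k-1})}_{\hat b_{k-1}}\big)\quad(k\ge1)$$ is well defined and, with $\hat\Lambda$ denoting the set of limit points of $(\hat b_k)$ in $\mathcal H$, has the following properties, all with respect to the norm topology of $\mathcal H$: 1. $\mathcal L(\hat b_k)\to\ell$ as $k\to\infty$ for some $\ell\in\mathbb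 R$; 2. $\{\hat b_k:k\ge0\}$ is precompact, and $\hat\Lambda\subset\mathcal S$; 3. $\hat\Lambda\subset\{b\in\mathcal H:\mathcal L(b)=\ell\}$, with the $\ell$ of part 1; 4. $\hat\Lambda$ is connected. -/

import Mathlib

open MeasureTheory Filter Topology Set
open scoped ENNReal Matrix Matrix.Norms.L2Operator

namespace EMDrift

/-- The Euclidean space `ℝ^d`. -/
abbrev Euc (d : ℕ) : Type := EuclideanSpace ℝ (Fin d)

/-- Discrete trajectories `(x_0, …, x_N)`, i.e. the space `ℝ^{d × (N + 1)}` with its Lebesgue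
measure `volume`. -/
abbrev Path (d N : ℕ) : Type := Fin (N + 1) → Euc d

/-- The density at `x` of the normal distribution on `ℝ^d` with mean `m` and covariance `S`. -/
noncomputable def gaussianDensity {d : ℕ} (m : Euc d) (S : Matrix (Fin d) (Fin d) ℝ)
    (x : Euc d) : ℝ :=
  (Real.sqrt ((2 * Real.pi) ^ d * S.det))⁻¹ *
    Real.exp (-((x - m).ofLp ⬝ᵥ (S⁻¹ *ᵥ (x - m).ofLp)) / 2)

/-- The known ingredients of the discretized SDE
`X(s_{n+1}) = X(s_n) + b(X(s_n)) Δ + σ(X(s_n)) ξ_{n+1} √Δ`, `0 ≤ n < N₀`,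
partially observed through `Y(t_m)`, `1 ≤ m ≤ M₀`, where `t_m = s_{obsIdx m}`,
together with the observed data `y`. The drift `b` is not part of it. -/
structure ObservedDiffusion (d d₀ N₀ M₀ : ℕ) where
  /-- step size -/
  Δ : ℝ
  Δ_pos : 0 < Δ
  /-- density of `X(s_0)` -/
  f₀ : Euc d → ℝ
  f₀_measurable : Measurable f₀
  f₀_nonneg : ∀ x, 0 ≤ f₀ x
  f₀_lintegral : ∫⁻ x, ENNReal.ofReal (f₀ x) = 1
  /-- diffusion coefficient -/
  σ : Euc d → Matrix (Fin d) (Fin d) ℝ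
  σ_measurable : ∀ i j, Measurable fun x => σ x i j
  /-- `ρ u x` is the conditional density at `u` of `Y(t_m)` given `X(t_m) = x` -/
  ρ : Euc d₀ → Euc d → ℝ
  ρ_measurable : Measurable fun q : Euc d₀ × Euc d => ρ q.1 q.2
  ρ_nonneg : ∀ u x, 0 ≤ ρ u x
  ρ_lintegral : ∀ x, ∫⁻ u, ENNReal.ofReal (ρ u x) = 1
  /-- position of the observation times in the time grid -/
  obsIdx : Fin M₀ → Fin (N₀ + 1)
  /-- the observed data -/
  y : Fin M₀ → Euc d₀

namespace ObservedDiffusion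

variable {d d₀ N₀ M₀ : ℕ} (𝓜 : ObservedDiffusion d d₀ N₀ M₀)

/-- `a = σ σᵀ`. -/
def a (x : Euc d) : Matrix (Fin d) (Fin d) ℝ := 𝓜.σ x * (𝓜.σ x)ᵀ

/-- The density `f_X(x_{0:N₀} | b)` of the latent trajectory when the drift is `b`. -/
noncomputable def pathDensity (b : Euc d → Euc d) (x : Path d N₀) : ℝ :=
  𝓜.f₀ (x 0) * ∏ n : Fin N₀,
    gaussianDensity (x n.castSucc + 𝓜.Δ • b (x n.castSucc)) (𝓜.Δ • 𝓜.a (x n.castSucc)) (x n.succ)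

/-- The joint density `f_{X,Y}(x_{0:N₀}, y_{1:M₀} | b)` of trajectory and observations, at the
observed data `y`. -/
noncomputable def jointDensity (b : Euc d → Euc d) (x : Path d N₀) : ℝ :=
  𝓜.pathDensity b x * ∏ m : Fin M₀, 𝓜.ρ (𝓜.y m) (x (𝓜.obsIdx m))

/-- The marginal density `f_Y(y_{1:M₀} | b)` of the observations, at the observed data `y`. -/
noncomputable def obsDensity (b : Euc d → Euc d) : ℝ :=
  ∫ x : Path d N₀, 𝓜.jointDensity b x

/-- The filtering distribution of the trajectory given the data `y`, for the drift `b`. -/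
noncomputable def filter (b : Euc d → Euc d) : Measure (Path d N₀) :=
  volume.withDensity fun x => ENNReal.ofReal (𝓜.jointDensity b x / 𝓜.obsDensity b)

end ObservedDiffusion

/-- The integral `∫ g dμ ∈ [-∞, ∞]` of an extended real function, as the difference of the
integrals of its positive and negative parts. -/
noncomputable def extIntegral {Ω : Type*} [MeasurableSpace Ω] (μ : Measure Ω)
    (g : Ω → EReal) : EReal :=
  ((∫⁻ x, (g x).toENNReal ∂μ : ℝ≥0∞) : EReal) - ((∫⁻ x, (-g x).toENNReal ∂μ : ℝ≥0∞) : EReal)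

/-- The probability measures on trajectories all of whose one-time marginals have an absolute
moment of order `p` that is at most `C`. -/
def momentClass (d N : ℕ) (p C : ℝ) : Set (ProbabilityMeasure (Path d N)) :=
  {μ | ∀ k, ∫⁻ x, ENNReal.ofReal (‖x k‖ ^ p) ∂(μ : Measure (Path d N)) ≤ ENNReal.ofReal C}

section RKHS

variable {d d₀ N₀ M₀ : ℕ} (𝓜 : ObservedDiffusion d d₀ N₀ M₀)
variable {H : Type*} [NormedAddCommGroup H] [InnerProductSpace ℝ H] [RKHS ℝ H (Euc d) (Euc d)]

/-- The penalized negative log-likelihood `-ln f_Y(y | b) + lam ‖b‖²`. -/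
noncomputable def loss (lam : ℝ) (b : H) : ℝ :=
  -Real.log (𝓜.obsDensity b) + lam * ‖b‖ ^ 2

/-- The risk `-∫ ln f_X(x | b) μ(dx) + lam ‖b‖²`. -/
noncomputable def risk (lam : ℝ) (b : H) (μ : Measure (Path d N₀)) : EReal :=
  extIntegral μ (fun x => -ENNReal.log (ENNReal.ofReal (𝓜.pathDensity b x)))
    + ((lam * ‖b‖ ^ 2 : ℝ) : EReal)

/-- `b = Φ(μ)` for the M-step map `Φ`: `b` is the unique minimizer of `risk(·, μ)` over `H`. -/
def IsMStep (lam : ℝ) (μ : Measure (Path d N₀)) (b : H) : Prop :=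
  ∀ b' : H, b' ≠ b → risk 𝓜 lam b μ < risk 𝓜 lam b' μ

variable (H) in
/-- The stationary set `{b ∈ H : b = Φ(filtering distribution for b)}`. -/
def stationarySet (lam : ℝ) : Set H :=
  {b | IsMStep 𝓜 lam (𝓜.filter b) b}

/-- `bhat 0 = b₀` and `bhat (k + 1) = Φ(approx (bhat k) (L k))` for all `k`. -/
def IsApproxEMSeq (lam : ℝ) (approx : H → ℕ → ProbabilityMeasure (Path d N₀)) (L : ℕ → ℕ)
    (b₀ : H) (bhat : ℕ → H) : Prop :=
  bhat 0 = b₀ ∧ ∀ k, IsMStep 𝓜 lam (approx (bhat k) (L k) : Measure (Path d N₀)) (bhat (k + 1))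

/-- The set of (strong) limit points of a sequence. -/
def limitSet (bhat : ℕ → H) : Set H :=
  {b | MapClusterPt b atTop bhat}

/-- The assumptions on the model and on the RKHS `H` with kernel `RKHS.kernel H`. Matrix norms are
spectral norms. -/
structure ModelAssumption [CompleteSpace H] (Cσ Ca CK B s α κ : ℝ) : Prop where
  Cσ_nonneg : 0 ≤ Cσ
  Ca_nonneg : 0 ≤ Ca
  CK_nonneg : 0 ≤ CK
  B_nonneg : 0 ≤ B
  s_nonneg : 0 ≤ s
  α_nonneg : 0 ≤ α
  κ_nonneg : 0 ≤ κ
  identifiable : ∀ b b' : H, (∀ x, 𝓜.pathDensity b x = 𝓜.pathDensity b' x) → b = b'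
  kernel_continuous_left : ∀ v, Continuous fun u => RKHS.kernel H u v
  kernel_continuous_right : ∀ u, Continuous fun v => RKHS.kernel H u v
  kernel_continuous_diag : Continuous fun u => RKHS.kernel H u u
  kernel_bound : ∀ u, ‖RKHS.kernel H u u‖ ≤ CK * (1 + ‖u‖ ^ κ)
  σ_bound : ∀ u, ‖𝓜.σ u‖ ≤ Cσ * (1 + ‖u‖ ^ s)
  a_isUnit : ∀ u, IsUnit (𝓜.a u)
  a_inv_bound : ∀ u, ‖(𝓜.a u)⁻¹‖ ≤ Ca * (1 + ‖u‖ ^ α)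
  ρ_bound : ∀ u x, 𝓜.ρ u x ≤ B

end RKHS

end EMDrift

/-!
# Convergence of an approximate EM iteration for drift estimation

The negative log-likelihood of a trajectory is, up to a term that does not depend on the drift,
the quadratic `energy`, so that for a measure `μ` with enough moments the risk is a constant plus
`∫ energy b dμ + lam * ‖b‖ ^ 2`. Point evaluations in `H` are bounded with polynomially growing
norm, hence this is a bounded strongly convex quadratic function of `b ∈ H`. Its Euler-Lagrange
equation (`IsCritical`) is solvable by Lax-Milgram, the solution `v` is the unique minimizer, and
the risk of `b` exceeds the minimum by at least `lam * ‖b - v‖ ^ 2`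
(`ModelAssumption.integral_energy_add_le`). Write `Ψ b` for the M-step at the filtering distribution
of `b`. Jensen's inequality (`ModelAssumption.loss_sub_loss_le`) turns strong convexity into
`loss (Ψ b) ≤ loss b - lam * ‖Ψ b - b‖ ^ 2`.

The M-step depends continuously on the measure with respect to total variation weighted by
`growthWeight`, `(1 + ‖x‖) ^ (2 max(κ, 1) + α)` (`ModelAssumption.tendsto_of_isCritical`). Plain
total variation convergence upgrades to the weighted one as soon as moments of a higher order are
bounded (`weightedTVTendsto_growthWeight`). This is used twice.

* Convergence in relative entropy implies total variation convergence, so the M-steps of the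
  approximations `approx b L` converge to `Ψ b`. That the risk is finite for them, i.e. that the
  log-density of the trajectory is integrable, follows from the Young inequality for relative
  entropy, since the square root of the density of the trajectory is integrable.
* If a bounded sequence of drifts converges pointwise, then the densities of the trajectory
  converge pointwise, hence in `L¹` by Scheffé's lemma. Since all moments of the trajectory are
  bounded uniformly over bounded sets of drifts (`ModelAssumption.exists_moment_bound`), the
  M-steps `Ψ` converge in norm (`ModelAssumption.weightedTVTendsto_filter`). As `H` is separable,
  every bounded sequence has a weakly, hence pointwise, convergent subsequence; therefore `Ψ` is
  continuous and maps bounded sets to relatively compact ones.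

The rest is the abstract statement `exists_approx_iteration`: choosing the approximation at step `k`
so accurate that the loss is within `2 ^ (-k)` of that of the exact step makes the loss converge and
`Ψ (bhat k) - bhat k` tend to zero; the iterates stay close to the relatively compact image under
`Ψ` of a ball, their limit points are fixed points of `Ψ` with a common loss, and the increments
tend to zero, so that the set of limit points is connected
(`isConnected_setOf_mapClusterPt`).
-/

/-! ### Limit points of slowly varying sequences -/

namespace EMDrift

/-- Ostrowski's theorem: if the increments of a sequence in a compact set tend to zero, then
its set of limit points is connected. -/
theorem isConnected_setOf_mapClusterPt {E : Type*} [MetricSpace E] {K : Set E} (hK : IsCompact K)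
    {u : ℕ → E} (hu : ∀ n, u n ∈ K) (hd : Tendsto (fun n => dist (u (n + 1)) (u n)) atTop (𝓝 0)) :
    IsConnected {x | MapClusterPt x atTop u} := by
  set Λ : Set E := {x | MapClusterPt x atTop u} with hΛ
  have hclosed : IsClosed Λ := isClosed_setOfPred_clusterPt
  have hΛK : Λ ⊆ K := fun x hx =>
    hK.isClosed.mem_of_mapClusterPt hx (Eventually.of_forall hu)
  have hΛc : IsCompact Λ := hK.of_isClosed_subset hclosed hΛK
  refine ⟨?_, ?_⟩
  · obtain ⟨x, -, hx⟩ := hK.exists_mapClusterPt_of_frequently (l := atTop) (f := u)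
      (Eventually.of_forall hu).frequently
    exact ⟨x, hx⟩
  rw [isPreconnected_iff_subset_of_fully_disjoint_closed hclosed]
  intro V W hV hW hVW hdis
  by_contra! hcon
  obtain ⟨⟨y, hyΛ, hyV⟩, ⟨z, hzΛ, hzW⟩⟩ :=
    And.intro (not_subset.1 hcon.1) (not_subset.1 hcon.2)
  have hyW : y ∈ W := (hVW hyΛ).resolve_left hyV
  have hzV : z ∈ V := (hVW hzΛ).resolve_right hzW
  have hdis' : Disjoint (Λ ∩ V) (Λ ∩ W) := hdis.mono inter_subset_right inter_subset_right
  obtain ⟨δ, hδ, hthick⟩ := hdis'.exists_thickenings (hΛc.inter_right hV) (hclosed.inter hW)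
  set A := Metric.thickening (δ / 2) (Λ ∩ V)
  set B := Metric.thickening (δ / 2) (Λ ∩ W)
  have hev : ∀ᶠ n in atTop, u n ∈ A ∪ B := by
    by_contra hne
    have hfr : ∃ᶠ n in atTop, u n ∈ K \ (A ∪ B) := by
      rw [not_eventually] at hne
      exact hne.mono fun n hn => ⟨hu n, hn⟩
    obtain ⟨x, hx, hxΛ⟩ := (hK.diff (Metric.isOpen_thickening.union
      Metric.isOpen_thickening)).exists_mapClusterPt_of_frequently hfr
    apply hx.2
    rcases hVW hxΛ with h | h
    · exact Or.inl (Metric.self_subset_thickening (half_pos hδ) _ ⟨hxΛ, h⟩)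
    · exact Or.inr (Metric.self_subset_thickening (half_pos hδ) _ ⟨hxΛ, h⟩)
  have hdist : ∀ᶠ n in atTop, dist (u (n + 1)) (u n) < δ / 2 :=
    hd.eventually (gt_mem_nhds (half_pos hδ))
  have hfrA : ∃ᶠ n in atTop, u n ∈ A := (mapClusterPt_iff_frequently.1 hzΛ) _
    (Metric.isOpen_thickening.mem_nhds (Metric.self_subset_thickening (half_pos hδ) _ ⟨hzΛ, hzV⟩))
  have hfrB : ∃ᶠ n in atTop, u n ∈ B := (mapClusterPt_iff_frequently.1 hyΛ) _
    (Metric.isOpen_thickening.mem_nhds (Metric.self_subset_thickening (half_pos hδ) _ ⟨hyΛ, hyW⟩))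
  have hdisj : ∀ x ∈ A, x ∉ B := fun x hx hx' => (Set.disjoint_left.1 hthick)
    (Metric.thickening_mono (half_le_self hδ.le) _ hx)
    (Metric.thickening_mono (half_le_self hδ.le) _ hx')
  obtain ⟨N, hN⟩ := eventually_atTop.1 (hev.and hdist)
  obtain ⟨n₀, hn₀, hn₀A⟩ := frequently_atTop.1 hfrA N
  -- a step shorter than `δ / 2` cannot lead from `A` to `B`
  have hstay : ∀ n ≥ n₀, u n ∈ A := by
    intro n hn
    induction n, hn using Nat.le_induction with
    | base => exact hn₀A
    | succ n hn ih =>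
      have h1 := (hN (n + 1) (by omega)).1
      refine h1.resolve_right fun hB => ?_
      obtain ⟨p, hp, hpd⟩ := Metric.mem_thickening_iff.1 ih
      refine (Set.disjoint_left.1 hthick) (Metric.mem_thickening_iff.2 ⟨p, hp, ?_⟩)
        (Metric.thickening_mono (half_le_self hδ.le) _ hB)
      have h2 := (hN n (by omega)).2
      linarith [dist_triangle (u (n + 1)) (u n) p]
  obtain ⟨n₁, hn₁, hn₁B⟩ := frequently_atTop.1 hfrB n₀
  exact hdisj _ (hstay n₁ hn₁) hn₁B

theorem isCompact_closure_image_of_subseq {E F : Type*} [MetricSpace E] [MetricSpace F]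
    (f : E → F) (s : Set E)
    (h : ∀ u : ℕ → E, (∀ n, u n ∈ s) →
      ∃ (y : F) (φ : ℕ → ℕ), StrictMono φ ∧ Tendsto (fun n => f (u (φ n))) atTop (𝓝 y)) :
    IsCompact (closure (f '' s)) := by
  apply IsSeqCompact.isCompact
  intro y hy
  have : ∀ n, ∃ x ∈ s, dist (y n) (f x) < 1 / ((n : ℝ) + 1) := fun n => by
    obtain ⟨_, ⟨x, hx, rfl⟩, hd⟩ := Metric.mem_closure_iff.1 (hy n) _ (Nat.one_div_pos_of_nat (n := n))
    exact ⟨x, hx, hd⟩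
  choose x hx hd using this
  obtain ⟨z, φ, hφ, hz⟩ := h x hx
  have hlim : Tendsto (y ∘ φ) atTop (𝓝 z) := by
    refine hz.congr_dist ?_
    have h0 : Tendsto (fun n => 1 / ((φ n : ℝ) + 1)) atTop (𝓝 0) :=
      (tendsto_one_div_add_atTop_nhds_zero_nat (𝕜 := ℝ)).comp hφ.tendsto_atTop
    refine squeeze_zero (fun _ => dist_nonneg) (fun n => ?_) h0
    rw [dist_comm]
    exact (hd (φ n)).le
  exact ⟨z, isClosed_closure.mem_of_tendsto hlim (Eventually.of_forall fun n => hy _), φ, hφ, hlim⟩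

/-! ### Inexact descent iterations -/

/-- A sequence that decreases up to the errors `2^{-k}` and is bounded below converges, and the
decrements `g` tend to zero. -/
theorem tendsto_of_le_sub_add {f g : ℕ → ℝ} {c : ℝ} (hc : ∀ k, c ≤ f k) (hg : ∀ k, 0 ≤ g k)
    (h : ∀ k, f (k + 1) ≤ f k - g k + (1 / 2) ^ k) :
    (∃ ℓ, Tendsto f atTop (𝓝 ℓ)) ∧ Tendsto g atTop (𝓝 0) := by
  have hp : Tendsto (fun k : ℕ => 2 * (1 / 2 : ℝ) ^ k) atTop (𝓝 (2 * 0)) :=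
    (tendsto_pow_atTop_nhds_zero_of_lt_one (by norm_num) (by norm_num)).const_mul 2
  set F : ℕ → ℝ := fun k => f k + 2 * (1 / 2) ^ k with hF
  have hstep : ∀ k, F (k + 1) ≤ F k - g k := fun k => by
    have := h k
    simp only [hF, pow_succ]
    linarith
  have hanti : Antitone F := antitone_nat_of_succ_le fun k => by linarith [hstep k, hg k]
  have hbdd : BddBelow (range F) := by
    refine ⟨c, ?_⟩
    rintro _ ⟨k, rfl⟩
    have : (0 : ℝ) ≤ 2 * (1 / 2) ^ k := by positivity
    simp only [hF]
    linarith [hc k]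
  have hlim := tendsto_atTop_ciInf hanti hbdd
  refine ⟨⟨⨅ i, F i, ?_⟩, ?_⟩
  · have := hlim.sub hp
    simpa [hF] using this
  · have h1 := hlim.sub (hlim.comp (tendsto_add_atTop_nat 1))
    rw [sub_self] at h1
    exact squeeze_zero hg (fun k => by
      have := hstep k
      simp only [Function.comp_apply]
      linarith) h1

/-- Convergence of an inexact iteration `b_{k+1} ≈ Ψ (b_k)` of a map `Ψ` that maps bounded sets to
relatively compact sets and decreases a coercive function `loss` by at least
`lam * ‖Ψ b - b‖ ^ 2`. The relation `step b L b'` says that `b'` is the approximation of `Ψ b` of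
index `L`. -/
theorem exists_approx_iteration {H : Type*} [NormedAddCommGroup H] [CompleteSpace H]
    {lam : ℝ} (hlam : 0 < lam) {loss : H → ℝ} {Ψ : H → H} {step : H → ℕ → H → Prop}
    (hdesc : ∀ b, loss (Ψ b) ≤ loss b - lam * ‖Ψ b - b‖ ^ 2)
    (hcoer : ∃ c, ∀ b, lam * ‖b‖ ^ 2 - c ≤ loss b)
    (hcont : Continuous loss) (hΨ : Continuous Ψ)
    (hcomp : ∀ (r : ℝ) (u : ℕ → H), (∀ n, ‖u n‖ ≤ r) →
      ∃ (y : H) (φ : ℕ → ℕ), StrictMono φ ∧ Tendsto (fun n => Ψ (u (φ n))) atTop (𝓝 y))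
    (happ : ∀ b, ∀ ε > 0, ∃ L, 0 < L ∧ ∃ b', step b L b' ∧ ‖b' - Ψ b‖ < ε) (b₀ : H) :
    ∃ (L : ℕ → ℕ) (bhat : ℕ → H), (∀ k, 0 < L k) ∧
      (bhat 0 = b₀ ∧ ∀ k, step (bhat k) (L k) (bhat (k + 1))) ∧
      ∃ ℓ : ℝ, Tendsto (fun k => loss (bhat k)) atTop (𝓝 ℓ) ∧
        IsCompact (closure (range bhat)) ∧
        {b | MapClusterPt b atTop bhat} ⊆ {b | Ψ b = b} ∧
        {b | MapClusterPt b atTop bhat} ⊆ {b | loss b = ℓ} ∧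
        IsConnected {b | MapClusterPt b atTop bhat} := by
  -- the loss is controlled along with the distance to `Ψ b`, by continuity of the loss at `Ψ b`
  have hsel : ∀ (k : ℕ) (b : H), ∃ q : ℕ × H, 0 < q.1 ∧ step b q.1 q.2 ∧
      ‖q.2 - Ψ b‖ < (1 / 2) ^ k ∧ loss q.2 ≤ loss (Ψ b) + (1 / 2) ^ k := by
    intro k b
    have hpos : (0 : ℝ) < (1 / 2) ^ k := by positivity
    obtain ⟨δ, hδ, hδl⟩ := Metric.continuous_iff.1 hcont (Ψ b) _ hpos
    obtain ⟨L, hL, b', hs, hb'⟩ := happ b (min δ ((1 / 2) ^ k)) (lt_min hδ hpos)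
    refine ⟨(L, b'), hL, hs, hb'.trans_le (min_le_right _ _), ?_⟩
    have := hδl b' (by rw [dist_eq_norm]; exact hb'.trans_le (min_le_left _ _))
    rw [Real.dist_eq] at this
    linarith [(abs_lt.1 this).2]
  choose q hq0 hqs hqd hql using hsel
  set bhat : ℕ → H := fun k => Nat.rec b₀ (fun k b => (q k b).2) k with hbhat
  have hsucc : ∀ k, bhat (k + 1) = (q k (bhat k)).2 := fun k => rfl
  obtain ⟨c, hc⟩ := hcoer
  have hlow : ∀ k, -c ≤ loss (bhat k) := fun k => by
    have := hc (bhat k)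
    have h2 : 0 ≤ lam * ‖bhat k‖ ^ 2 := by positivity
    linarith
  obtain ⟨⟨ℓ, hℓ⟩, hg⟩ := tendsto_of_le_sub_add (f := fun k => loss (bhat k))
    (g := fun k => lam * ‖Ψ (bhat k) - bhat k‖ ^ 2) hlow (fun k => by positivity) (fun k => by
      have h1 := hdesc (bhat k)
      have h2 := hql k (bhat k)
      rw [hsucc]
      linarith)
  -- the residuals of the exact map tend to zero
  have hres : Tendsto (fun k => ‖Ψ (bhat k) - bhat k‖) atTop (𝓝 0) := by
    have h1 : Tendsto (fun k => ‖Ψ (bhat k) - bhat k‖ ^ 2) atTop (𝓝 0) := by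
      have := hg.const_mul lam⁻¹
      simpa [← mul_assoc, inv_mul_cancel₀ hlam.ne'] using this
    have h2 := (Real.continuous_sqrt.tendsto 0).comp h1
    simpa [Function.comp_def, Real.sqrt_sq (norm_nonneg _)] using h2
  have herr : Tendsto (fun k => ‖bhat (k + 1) - Ψ (bhat k)‖) atTop (𝓝 0) :=
    squeeze_zero (fun _ => norm_nonneg _) (fun k => (hqd k (bhat k)).le)
      (tendsto_pow_atTop_nhds_zero_of_lt_one (by norm_num) (by norm_num))
  obtain ⟨M, hM⟩ := hℓ.bddAbove_range
  have hbound : ∀ k, ‖bhat k‖ ≤ √((M + c) / lam) := fun k => by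
    apply Real.le_sqrt_of_sq_le
    rw [le_div_iff₀ hlam]
    linarith [hc (bhat k), hM ⟨k, rfl⟩]
  set r := √((M + c) / lam)
  have hKc : IsCompact (closure (Ψ '' Metric.closedBall 0 r)) :=
    isCompact_closure_image_of_subseq Ψ _ fun u hu =>
      hcomp r u fun n => mem_closedBall_zero_iff.1 (hu n)
  -- all but finitely many iterates are close to the relatively compact set `Ψ '' closedBall 0 r`
  have hcpt : IsCompact (closure (range bhat)) := by
    refine TotallyBounded.isCompact_of_isClosed ?_ isClosed_closure
    refine TotallyBounded.closure (Metric.totallyBounded_iff.2 fun ε hε => ?_)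
    obtain ⟨t, htf, ht⟩ := Metric.totallyBounded_iff.1 hKc.totallyBounded (ε / 2) (half_pos hε)
    obtain ⟨N, hN⟩ := eventually_atTop.1 (herr.eventually (gt_mem_nhds (half_pos hε)))
    refine ⟨t ∪ bhat '' Iic N, htf.union ((finite_Iic N).image _), ?_⟩
    rintro _ ⟨k, rfl⟩
    rw [mem_iUnion₂]
    rcases le_or_gt k N with hk | hk
    · exact ⟨bhat k, Or.inr ⟨k, hk, rfl⟩, Metric.mem_ball_self hε⟩
    · obtain ⟨j, rfl⟩ : ∃ j, k = j + 1 := ⟨k - 1, by omega⟩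
      have h1 := ht (subset_closure ⟨bhat j, mem_closedBall_zero_iff.2 (hbound j), rfl⟩)
      obtain ⟨y, hy, hyd⟩ := mem_iUnion₂.1 h1
      refine ⟨y, Or.inl hy, ?_⟩
      rw [Metric.mem_ball] at hyd ⊢
      have h2 := hN j (by omega)
      rw [← dist_eq_norm] at h2
      linarith [dist_triangle (bhat (j + 1)) (Ψ (bhat j)) y]
  refine ⟨fun k => (q k (bhat k)).1, bhat, fun k => hq0 k _, ⟨rfl, fun k => hqs k _⟩, ℓ, hℓ, hcpt,
    fun b hb => ?_, fun b hb => ?_, ?_⟩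
  · obtain ⟨φ, hφ, hlim⟩ := MapClusterPt.tendsto_subseq hb
    have h1 := (((hΨ.tendsto b).comp hlim).sub hlim).norm
    have h2 := tendsto_nhds_unique h1 (hres.comp hφ.tendsto_atTop)
    exact sub_eq_zero.1 (norm_eq_zero.1 h2)
  · obtain ⟨φ, hφ, hlim⟩ := MapClusterPt.tendsto_subseq hb
    exact tendsto_nhds_unique ((hcont.tendsto b).comp hlim) (hℓ.comp hφ.tendsto_atTop)
  · refine isConnected_setOf_mapClusterPt hcpt (fun n => subset_closure ⟨n, rfl⟩) ?_
    have h1 := herr.add hres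
    rw [add_zero] at h1
    refine squeeze_zero (fun _ => dist_nonneg) (fun k => ?_) h1
    rw [dist_eq_norm]
    calc ‖bhat (k + 1) - bhat k‖
        = ‖(bhat (k + 1) - Ψ (bhat k)) + (Ψ (bhat k) - bhat k)‖ := by congr 1; abel
      _ ≤ _ := norm_add_le _ _

end EMDrift

/-! ### Weighted total variation convergence -/

namespace EMDrift

open InformationTheory

variable {Ω : Type*} [MeasurableSpace Ω]

/-- Convergence of measures in total variation weighted by `w`: the integrals of all measurable
functions dominated by `w` converge, uniformly in these functions. -/
def WeightedTVTendsto (w : Ω → ℝ) (μs : ℕ → Measure Ω) (μ : Measure Ω) : Prop :=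
  ∀ ε > 0, ∀ᶠ k in atTop, ∀ h : Ω → ℝ, Measurable h → (∀ x, |h x| ≤ w x) →
    |∫ x, h x ∂μs k - ∫ x, h x ∂μ| ≤ ε

/-- Total variation convergence allows test functions with an arbitrary bound. -/
theorem WeightedTVTendsto.eventually_le {μs : ℕ → Measure Ω} {μ : Measure Ω}
    (h : WeightedTVTendsto (fun _ => 1) μs μ) {R : ℝ} (hR : 0 < R) {ε : ℝ} (hε : 0 < ε) :
    ∀ᶠ k in atTop, ∀ g : Ω → ℝ, Measurable g → (∀ x, |g x| ≤ R) →
      |∫ x, g x ∂μs k - ∫ x, g x ∂μ| ≤ ε := by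
  filter_upwards [h (ε / R) (by positivity)] with k hk g hg hgR
  have h1 := hk (fun x => g x / R) (hg.div_const R) (fun x => by
    rw [abs_div, abs_of_pos hR, div_le_one hR]
    exact hgR x)
  rw [integral_div, integral_div, ← sub_div, abs_div, abs_of_pos hR] at h1
  exact (div_le_div_iff_of_pos_right hR).1 h1

/-- Lower semicontinuity of moments under total variation convergence. -/
theorem WeightedTVTendsto.lintegral_le {μs : ℕ → Measure Ω} {μ : Measure Ω}
    [∀ k, IsProbabilityMeasure (μs k)] [IsProbabilityMeasure μ]
    (h : WeightedTVTendsto (fun _ => 1) μs μ) {g : Ω → ℝ} (hg : Measurable g)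
    (hg0 : ∀ x, 0 ≤ g x) {C : ℝ}
    (hC : ∀ᶠ k in atTop, ∫⁻ x, ENNReal.ofReal (g x) ∂μs k ≤ ENNReal.ofReal C) :
    ∫⁻ x, ENNReal.ofReal (g x) ∂μ ≤ ENNReal.ofReal C := by
  -- the truncations of `g` are bounded test functions
  have key : ∀ N : ℕ, ∫⁻ x, ENNReal.ofReal (min (g x) N) ∂μ ≤ ENNReal.ofReal C := by
    intro N
    have hm : Measurable fun x => min (g x) N := hg.min measurable_const
    have hnn : ∀ x, 0 ≤ min (g x) (N : ℝ) := fun x => le_min (hg0 x) (Nat.cast_nonneg N)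
    have hb : ∀ x, |min (g x) N| ≤ (N : ℝ) + 1 := fun x => by
      rw [abs_of_nonneg (hnn x)]
      linarith [min_le_right (g x) (N : ℝ)]
    have hi : ∀ (ν : Measure Ω) [IsProbabilityMeasure ν],
        Integrable (fun x => min (g x) (N : ℝ)) ν := fun ν _ =>
      Integrable.of_bound hm.aestronglyMeasurable ((N : ℝ) + 1)
        (Eventually.of_forall fun x => by rw [Real.norm_eq_abs]; exact hb x)
    have ht : Tendsto (fun k => ∫ x, min (g x) N ∂μs k) atTop (𝓝 (∫ x, min (g x) N ∂μ)) := by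
      rw [Metric.tendsto_nhds]
      intro ε hε
      filter_upwards [h.eventually_le (R := (N : ℝ) + 1) (by positivity) (half_pos hε)] with k hk
      rw [Real.dist_eq]
      linarith [hk _ hm hb]
    rw [← ofReal_integral_eq_lintegral_ofReal (hi μ) (Eventually.of_forall hnn)]
    refine le_of_tendsto ((ENNReal.continuous_ofReal.tendsto _).comp ht) ?_
    filter_upwards [hC] with k hk
    simp only [Function.comp_apply]
    rw [ofReal_integral_eq_lintegral_ofReal (hi _) (Eventually.of_forall hnn)]
    exact (lintegral_mono fun x => ENNReal.ofReal_le_ofReal (min_le_left _ _)).trans hk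
  have hsup : ∀ x, ENNReal.ofReal (g x) = ⨆ N : ℕ, ENNReal.ofReal (min (g x) N) := fun x => by
    apply le_antisymm
    · obtain ⟨N, hN⟩ := exists_nat_ge (g x)
      exact le_iSup_of_le N (by rw [min_eq_left hN])
    · exact iSup_le fun N => ENNReal.ofReal_le_ofReal (min_le_left _ _)
  simp_rw [hsup]
  rw [lintegral_iSup]
  · exact iSup_le key
  · intro N
    exact (hg.min measurable_const).ennreal_ofReal
  · intro N N' hN x
    exact ENNReal.ofReal_le_ofReal (min_le_min le_rfl (by exact_mod_cast hN))

/-- Total variation convergence and a uniform bound on the integrals of `g` imply convergence in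
total variation with a weight `w` that is negligible with respect to `g` where it is large. -/
theorem WeightedTVTendsto.of_lintegral_le {μs : ℕ → Measure Ω} {μ : Measure Ω}
    [∀ k, IsProbabilityMeasure (μs k)] [IsProbabilityMeasure μ]
    (h : WeightedTVTendsto (fun _ => 1) μs μ) {g : Ω → ℝ} (hg : Measurable g)
    (hg0 : ∀ x, 0 ≤ g x) {C : ℝ}
    (hC : ∀ᶠ k in atTop, ∫⁻ x, ENNReal.ofReal (g x) ∂μs k ≤ ENNReal.ofReal C)
    {w : Ω → ℝ} (hw : Measurable w)
    (hwg : ∀ η > 0, ∃ R > 0, ∀ x, R < w x → w x ≤ η * g x) :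
    WeightedTVTendsto w μs μ := by
  intro ε hε
  have hCμ := h.lintegral_le hg hg0 hC
  obtain ⟨R, hR, hRw⟩ := hwg (ε / (4 * (|C| + 1))) (by positivity)
  set η := ε / (4 * (|C| + 1)) with hη
  have hη0 : 0 < η := by positivity
  have hgi : ∀ ν : Measure Ω, ∫⁻ x, ENNReal.ofReal (g x) ∂ν ≤ ENNReal.ofReal C →
      Integrable g ν := fun ν hν => by
    refine (lintegral_ofReal_ne_top_iff_integrable hg.aestronglyMeasurable
      (Eventually.of_forall hg0)).1 (ne_top_of_le_ne_top ENNReal.ofReal_ne_top hν)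
  have hgint : ∀ ν : Measure Ω, ∫⁻ x, ENNReal.ofReal (g x) ∂ν ≤ ENNReal.ofReal C →
      ∫ x, g x ∂ν ≤ |C| := fun ν hν => by
    rw [integral_eq_lintegral_of_nonneg_ae (Eventually.of_forall hg0) hg.aestronglyMeasurable]
    refine ENNReal.toReal_le_of_le_ofReal (abs_nonneg C) (hν.trans ?_)
    exact ENNReal.ofReal_le_ofReal (le_abs_self C)
  filter_upwards [h.eventually_le hR (half_pos hε), hC] with k hk hCk f hf hfw
  set A : Set Ω := {x | w x ≤ R} with hA
  have hAm : MeasurableSet A := measurableSet_le hw measurable_const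
  -- where `w > R`, the test function is dominated by `η * g`, of integral at most `ε / 4`
  have hsplit : ∀ (ν : Measure Ω) [IsProbabilityMeasure ν],
      ∫⁻ x, ENNReal.ofReal (g x) ∂ν ≤ ENNReal.ofReal C →
      |∫ x, f x ∂ν - ∫ x, A.indicator f x ∂ν| ≤ ε / 4 := by
    intro ν _ hν
    have hfi : Integrable f ν := by
      refine (((hgi ν hν).const_mul η).add (integrable_const R)).mono' hf.aestronglyMeasurable
        (Eventually.of_forall fun x => ?_)
      have h1 : 0 ≤ η * g x := mul_nonneg hη0.le (hg0 x)
      simp only [Pi.add_apply]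
      rw [Real.norm_eq_abs]
      rcases le_or_gt (w x) R with hx | hx
      · linarith [hfw x]
      · linarith [hfw x, hRw x hx]
    rw [← integral_sub hfi (hfi.indicator hAm), ← Real.norm_eq_abs]
    refine (norm_integral_le_of_norm_le ((hgi ν hν).const_mul η)
      (Eventually.of_forall fun x => ?_)).trans ?_
    · by_cases hx : x ∈ A
      · simp only [indicator_of_mem hx, sub_self, norm_zero]
        exact mul_nonneg hη0.le (hg0 x)
      · rw [indicator_of_notMem hx, sub_zero, Real.norm_eq_abs]
        exact (hfw x).trans (hRw x (not_le.1 hx))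
    · rw [integral_const_mul]
      calc η * ∫ x, g x ∂ν ≤ η * (|C| + 1) := by
            refine mul_le_mul_of_nonneg_left ?_ hη0.le
            linarith [hgint ν hν]
        _ = ε / 4 := by rw [hη]; field_simp
  have h1 := hsplit (μs k) hCk
  have h2 := hsplit μ hCμ
  have h3 := hk (A.indicator f) (hf.indicator hAm) (fun x => by
    by_cases hx : x ∈ A
    · rw [indicator_of_mem hx]
      exact (hfw x).trans hx
    · rw [indicator_of_notMem hx, abs_zero]
      exact hR.le)
  rw [abs_le] at h1 h2 h3 ⊢
  constructor <;> linarith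

/-- **Scheffé's lemma**: pointwise convergence of densities together with convergence of their
integrals implies convergence in `L¹`. -/
theorem tendsto_integral_abs_sub_of_tendsto {ν : Measure Ω} {fs : ℕ → Ω → ℝ} {f : Ω → ℝ}
    (hfs : ∀ k, Integrable (fs k) ν) (hf : Integrable f ν) (hfs0 : ∀ k x, 0 ≤ fs k x)
    (hf0 : ∀ x, 0 ≤ f x)
    (hlim : ∀ x, Tendsto (fun k => fs k x) atTop (𝓝 (f x)))
    (hint : Tendsto (fun k => ∫ x, fs k x ∂ν) atTop (𝓝 (∫ x, f x ∂ν))) :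
    Tendsto (fun k => ∫ x, |fs k x - f x| ∂ν) atTop (𝓝 0) := by
  have hpos : Tendsto (fun k => ∫ x, max (f x - fs k x) 0 ∂ν) atTop (𝓝 0) := by
    have := tendsto_integral_of_dominated_convergence (μ := ν)
      (F := fun k x => max (f x - fs k x) 0) (f := fun _ => (0 : ℝ)) f
      (fun k => ((hf.sub (hfs k)).sup (integrable_zero _ _ _)).aestronglyMeasurable) hf
      (fun k => Eventually.of_forall fun x => by
        rw [Real.norm_eq_abs, abs_of_nonneg (le_max_right _ _)]
        exact max_le (by linarith [hfs0 k x]) (hf0 x))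
      (Eventually.of_forall fun x => by
        have h1 := ((tendsto_const_nhds (x := f x)).sub (hlim x)).max
          (tendsto_const_nhds (x := (0 : ℝ)))
        simpa using h1)
    simpa using this
  have hsum := (hint.sub_const (∫ x, f x ∂ν)).add (hpos.const_mul 2)
  rw [sub_self, mul_zero, add_zero] at hsum
  refine hsum.congr fun k => ?_
  have hi1 : Integrable (fun x => max (f x - fs k x) 0) ν :=
    (hf.sub (hfs k)).sup (integrable_zero _ _ _)
  rw [← integral_sub (hfs k) hf, ← integral_const_mul,
    ← integral_add (f := fun x => fs k x - f x) ((hfs k).sub hf) (hi1.const_mul 2)]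
  refine integral_congr_ae (Eventually.of_forall fun x => ?_)
  simp only
  rcases le_total (f x) (fs k x) with hx | hx
  · rw [max_eq_right (by linarith), abs_of_nonneg (by linarith)]
    ring
  · rw [max_eq_left (by linarith), abs_of_nonpos (by linarith)]
    ring

theorem integral_withDensity_ofReal {ν : Measure Ω} {f h : Ω → ℝ} (hf : Measurable f)
    (hf0 : ∀ x, 0 ≤ f x) :
    ∫ x, h x ∂(ν.withDensity fun x => ENNReal.ofReal (f x)) = ∫ x, f x * h x ∂ν := by
  rw [integral_withDensity_eq_integral_toReal_smul hf.ennreal_ofReal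
    (Eventually.of_forall fun _ => ENNReal.ofReal_lt_top)]
  refine integral_congr_ae (Eventually.of_forall fun x => ?_)
  simp only [ENNReal.toReal_ofReal (hf0 x), smul_eq_mul]

theorem WeightedTVTendsto.of_tendsto_density {ν : Measure Ω} {fs : ℕ → Ω → ℝ} {f : Ω → ℝ}
    (hfsm : ∀ k, Measurable (fs k)) (hfm : Measurable f)
    (hfs : ∀ k, Integrable (fs k) ν) (hf : Integrable f ν) (hfs0 : ∀ k x, 0 ≤ fs k x)
    (hf0 : ∀ x, 0 ≤ f x)
    (hlim : Tendsto (fun k => ∫ x, |fs k x - f x| ∂ν) atTop (𝓝 0)) :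
    WeightedTVTendsto (fun _ => 1) (fun k => ν.withDensity fun x => ENNReal.ofReal (fs k x))
      (ν.withDensity fun x => ENNReal.ofReal (f x)) := by
  intro ε hε
  filter_upwards [hlim.eventually (gt_mem_nhds hε)] with k hk h hh hh1
  rw [integral_withDensity_ofReal (hfsm k) (hfs0 k), integral_withDensity_ofReal hfm hf0]
  have hi : ∀ {g : Ω → ℝ}, Integrable g ν → Integrable (fun x => g x * h x) ν := fun hg =>
    hg.mul_bdd (c := 1) hh.aestronglyMeasurable (Eventually.of_forall hh1)
  rw [← integral_sub (hi (hfs k)) (hi hf), ← Real.norm_eq_abs]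
  refine (norm_integral_le_of_norm_le ((hfs k).sub hf).abs
    (Eventually.of_forall fun x => ?_)).trans hk.le
  rw [← sub_mul, norm_mul]
  exact mul_le_of_le_one_right (abs_nonneg _) (hh1 x)

/-! ### Consequences of a small or finite relative entropy -/

/-- The Young inequality for the convex function `klFun` and its conjugate `exp - 1`. -/
theorem mul_le_klFun_add_exp_sub_one {u : ℝ} (hu : 0 ≤ u) (g : ℝ) :
    u * g ≤ klFun u + (Real.exp g - 1) := by
  rw [klFun_apply]
  rcases hu.eq_or_lt with rfl | hu
  · simp [Real.exp_nonneg]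
  have h1 := Real.add_one_le_exp (g - Real.log u)
  rw [Real.exp_sub, Real.exp_log hu, le_div_iff₀ hu] at h1
  nlinarith

/-- The Young inequality at `t` and at `-t`; a substitute for Pinsker's inequality. -/
theorem abs_sub_one_le_klFun_div_add {u : ℝ} (hu : 0 ≤ u) {t : ℝ} (ht : 0 < t) (ht1 : t ≤ 1) :
    |u - 1| ≤ klFun u / t + t := by
  have hq : ∀ s : ℝ, |s| ≤ 1 → Real.exp s - 1 - s ≤ s ^ 2 := fun s hs =>
    (le_abs_self _).trans (Real.abs_exp_sub_one_sub_id_le hs)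
  have h1 := mul_le_klFun_add_exp_sub_one hu t
  have h2 := mul_le_klFun_add_exp_sub_one hu (-t)
  have h3 := hq t (by rwa [abs_of_pos ht])
  have h4 := hq (-t) (by rwa [abs_neg, abs_of_pos ht])
  rw [div_add' _ _ _ ht.ne', le_div_iff₀ ht, ← abs_of_pos ht, ← abs_mul, abs_of_pos ht, abs_le]
  constructor <;> nlinarith

/-- Convergence in relative entropy implies convergence in total variation. -/
theorem WeightedTVTendsto.of_klDiv {μs : ℕ → Measure Ω} {π : Measure Ω}
    [∀ k, IsProbabilityMeasure (μs k)] [IsProbabilityMeasure π]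
    (h : Tendsto (fun k => klDiv (μs k) π) atTop (𝓝 0)) :
    WeightedTVTendsto (fun _ => 1) μs π := by
  intro ε hε
  set t : ℝ := min (ε / 2) 1 with ht
  have ht0 : 0 < t := lt_min (half_pos hε) one_pos
  have hpos : (0 : ℝ≥0∞) < ENNReal.ofReal (t * (ε / 2)) := ENNReal.ofReal_pos.2 (by positivity)
  filter_upwards [h.eventually (gt_mem_nhds hpos)] with k hk f hf hf1
  have hne : klDiv (μs k) π ≠ ∞ := hk.ne_top
  obtain ⟨hac, hllr⟩ := klDiv_ne_top_iff.1 hne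
  set u : Ω → ℝ := fun x => ((μs k).rnDeriv π x).toReal with hu
  have hum : Measurable u := ((μs k).measurable_rnDeriv π).ennreal_toReal
  have hui : Integrable u π := Measure.integrable_toReal_rnDeriv
  have hkli : Integrable (fun x => klFun (u x)) π := (integrable_klFun_rnDeriv_iff hac).2 hllr
  have hkl : ∫ x, klFun (u x) ∂π < t * (ε / 2) := by
    rw [← toReal_klDiv_eq_integral_klFun hac]
    exact (ENNReal.lt_ofReal_iff_toReal_lt hne).1 hk
  have hi : ∀ {g : Ω → ℝ}, Integrable g π → Integrable (fun x => g x * f x) π := fun hg =>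
    hg.mul_bdd (c := 1) hf.aestronglyMeasurable (Eventually.of_forall hf1)
  have hfi : Integrable f π :=
    Integrable.of_bound hf.aestronglyMeasurable 1 (Eventually.of_forall hf1)
  have h1 : ∫ x, f x ∂μs k = ∫ x, u x * f x ∂π := (integral_rnDeriv_smul hac).symm
  rw [h1, ← integral_sub (hi hui) hfi, ← Real.norm_eq_abs]
  refine (norm_integral_le_of_norm_le ((hkli.div_const t).add (integrable_const t))
    (Eventually.of_forall fun x => ?_)).trans ?_
  · have h2 := abs_sub_one_le_klFun_div_add (u := u x) ENNReal.toReal_nonneg ht0 (min_le_right _ _)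
    calc ‖u x * f x - f x‖ = |u x - 1| * |f x| := by
          rw [← abs_mul, Real.norm_eq_abs]; ring_nf
      _ ≤ |u x - 1| := mul_le_of_le_one_right (abs_nonneg _) (hf1 x)
      _ ≤ _ := h2
  · simp only [Pi.add_apply]
    rw [integral_add (hkli.div_const t) (integrable_const t), integral_div]
    simp only [integral_const, probReal_univ, smul_eq_mul, one_mul]
    have h3 : (∫ x, klFun (u x) ∂π) / t ≤ ε / 2 := by
      rw [div_le_iff₀ ht0]
      linarith
    linarith [min_le_left (ε / 2) 1]

/-- A nonnegative function with an exponential moment under `π` is integrable under every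
probability measure of finite relative entropy with respect to `π`. -/
theorem lintegral_ofReal_lt_top_of_klDiv_ne_top {μ π : Measure Ω} [IsProbabilityMeasure μ]
    [IsProbabilityMeasure π] (hkl : klDiv μ π ≠ ∞) {g : Ω → ℝ} (hg : Measurable g)
    (hexp : ∫⁻ x, ENNReal.ofReal (Real.exp (g x)) ∂π < ∞) :
    ∫⁻ x, ENNReal.ofReal (g x) ∂μ < ∞ := by
  obtain ⟨hac, -⟩ := klDiv_ne_top_iff.1 hkl
  rw [← lintegral_rnDeriv_mul hac hg.ennreal_ofReal.aemeasurable]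
  refine lt_of_le_of_lt ?_ (ENNReal.add_lt_top.2 ⟨lt_top_iff_ne_top.2 hkl, hexp⟩)
  have hm : Measurable fun x => ENNReal.ofReal (klFun (μ.rnDeriv π x).toReal) :=
    (measurable_klFun.comp (μ.measurable_rnDeriv π).ennreal_toReal).ennreal_ofReal
  rw [klDiv_eq_lintegral_klFun_of_ac hac, ← lintegral_add_left hm]
  refine lintegral_mono_ae ?_
  filter_upwards [Measure.rnDeriv_lt_top μ π] with x hx
  conv_lhs => rw [← ENNReal.ofReal_toReal hx.ne]
  rw [← ENNReal.ofReal_mul ENNReal.toReal_nonneg,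
    ← ENNReal.ofReal_add (klFun_nonneg ENNReal.toReal_nonneg) (Real.exp_nonneg _)]
  refine ENNReal.ofReal_le_ofReal ?_
  linarith [mul_le_klFun_add_exp_sub_one (u := (μ.rnDeriv π x).toReal)
    ENNReal.toReal_nonneg (g x)]

end EMDrift

namespace EMDrift

/-! ### Gaussian densities -/

theorem measurable_matrix_det {α : Type*} [MeasurableSpace α] {d : ℕ}
    {A : α → Matrix (Fin d) (Fin d) ℝ} (hA : ∀ i j, Measurable fun x => A x i j) :
    Measurable fun x => (A x).det := by
  simp_rw [Matrix.det_apply]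
  refine Finset.measurable_sum _ fun τ _ => ?_
  exact (Finset.measurable_prod _ fun i _ => hA _ _).const_smul _

theorem measurable_matrix_inv {α : Type*} [MeasurableSpace α] {d : ℕ}
    {A : α → Matrix (Fin d) (Fin d) ℝ} (hA : ∀ i j, Measurable fun x => A x i j) (i j : Fin d) :
    Measurable fun x => (A x)⁻¹ i j := by
  simp_rw [Matrix.inv_def, Matrix.smul_apply, Matrix.adjugate_apply, Ring.inverse_eq_inv',
    smul_eq_mul]
  refine (measurable_matrix_det hA).inv.mul (measurable_matrix_det fun k l => ?_)
  by_cases h : k = j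
  · subst h
    simp
  · simp only [Matrix.updateRow_ne h]
    exact hA k l

theorem measurable_dotProduct_mulVec {α : Type*} [MeasurableSpace α] {d : ℕ}
    {A : α → Matrix (Fin d) (Fin d) ℝ} (hA : ∀ i j, Measurable fun x => A x i j)
    {f g : α → Euc d} (hf : Measurable f) (hg : Measurable g) :
    Measurable fun x => (f x).ofLp ⬝ᵥ (A x *ᵥ (g x).ofLp) := by
  simp only [dotProduct, Matrix.mulVec]
  refine Finset.measurable_sum _ fun i _ => ?_
  refine Measurable.mul (by fun_prop) (Finset.measurable_sum _ fun j _ => ?_)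
  exact (hA i j).mul (by fun_prop)

theorem measurable_gaussianDensity {α : Type*} [MeasurableSpace α] {d : ℕ}
    {m x : α → Euc d} {S : α → Matrix (Fin d) (Fin d) ℝ} (hm : Measurable m)
    (hS : ∀ i j, Measurable fun t => S t i j) (hx : Measurable x) :
    Measurable fun t => gaussianDensity (m t) (S t) (x t) := by
  unfold gaussianDensity
  have h1 := measurable_matrix_det hS
  have h2 := measurable_dotProduct_mulVec (measurable_matrix_inv hS) (hx.sub hm) (hx.sub hm)
  exact (Real.continuous_sqrt.measurable.comp (h1.const_mul _)).inv.mul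
    (Real.measurable_exp.comp (h2.neg.div_const 2))

theorem gaussianDensity_nonneg {d : ℕ} (m : Euc d) (S : Matrix (Fin d) (Fin d) ℝ) (x : Euc d) :
    0 ≤ gaussianDensity m S x := by
  unfold gaussianDensity
  positivity

theorem gaussianDensity_zero_one {d : ℕ} (z : Euc d) :
    gaussianDensity 0 1 z = (√((2 * Real.pi) ^ d))⁻¹ * Real.exp (-(1 / 2) * ‖z‖ ^ 2) := by
  unfold gaussianDensity
  rw [Matrix.det_one, mul_one, inv_one, Matrix.one_mulVec, sub_zero, EuclideanSpace.norm_sq_eq]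
  congr 2
  simp only [dotProduct, Real.norm_eq_abs, sq_abs, ← sq]
  ring

theorem lintegral_gaussianDensity_zero_one (d : ℕ) :
    ∫⁻ z : Euc d, ENNReal.ofReal (gaussianDensity 0 1 z) = 1 := by
  have h := GaussianFourier.integral_rexp_neg_mul_sq_norm (V := Euc d) (b := 1 / 2) (by norm_num)
  have hpos : 0 < (2 * Real.pi) ^ d := by positivity
  have hval : (Real.pi / (1 / 2)) ^ ((Module.finrank ℝ (Euc d) : ℝ) / 2)
      = √((2 * Real.pi) ^ d) := by
    rw [finrank_euclideanSpace_fin, Real.sqrt_eq_rpow, ← Real.rpow_natCast, ← Real.rpow_mul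
      (by positivity)]
    congr 1
    · ring
    · ring
  rw [hval] at h
  have hi : Integrable fun z : Euc d => Real.exp (-(1 / 2) * ‖z‖ ^ 2) := by
    by_contra hni
    rw [integral_undef hni] at h
    exact (Real.sqrt_pos.2 hpos).ne h
  simp_rw [gaussianDensity_zero_one]
  rw [← ofReal_integral_eq_lintegral_ofReal (hi.const_mul _)
    (Eventually.of_forall fun z => by positivity), integral_const_mul, h,
    inv_mul_cancel₀ (Real.sqrt_pos.2 hpos).ne', ENNReal.ofReal_one]

theorem lintegral_pow_mul_gaussianDensity_zero_one_lt_top (d q : ℕ) :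
    ∫⁻ z : Euc d, ENNReal.ofReal ((1 + ‖z‖) ^ q * gaussianDensity 0 1 z) < ∞ := by
  have h := GaussianFourier.integral_rexp_neg_mul_sq_norm (V := Euc d) (b := 1 / 4) (by norm_num)
  have hi : Integrable fun z : Euc d => Real.exp (-(1 / 4) * ‖z‖ ^ 2) := by
    by_contra hni
    rw [integral_undef hni] at h
    have : 0 < (Real.pi / (1 / 4)) ^ ((Module.finrank ℝ (Euc d) : ℝ) / 2) := by positivity
    exact this.ne h
  set c := (√((2 * Real.pi) ^ d))⁻¹ with hc
  -- `(1 + t) ^ q ≤ q! * exp (1 + t)` and `1 + t - t ^ 2 / 2 ≤ 2 - t ^ 2 / 4`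
  refine lt_of_le_of_lt (lintegral_mono fun z => ENNReal.ofReal_le_ofReal ?_)
    (hi.const_mul (c * (q.factorial * Real.exp 2))).lintegral_lt_top
  rw [gaussianDensity_zero_one]
  have h1 : (1 + ‖z‖) ^ q ≤ q.factorial * Real.exp (1 + ‖z‖) := by
    have := Real.pow_div_factorial_le_exp (1 + ‖z‖) (by positivity) q
    rw [div_le_iff₀ (by positivity)] at this
    linarith
  have h2 : Real.exp (1 + ‖z‖) * Real.exp (-(1 / 2) * ‖z‖ ^ 2)
      ≤ Real.exp 2 * Real.exp (-(1 / 4) * ‖z‖ ^ 2) := by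
    rw [← Real.exp_add, ← Real.exp_add, Real.exp_le_exp]
    nlinarith [sq_nonneg (‖z‖ - 2)]
  have hc0 : 0 ≤ c := by positivity
  calc (1 + ‖z‖) ^ q * (c * Real.exp (-(1 / 2) * ‖z‖ ^ 2))
      ≤ (q.factorial * Real.exp (1 + ‖z‖)) * (c * Real.exp (-(1 / 2) * ‖z‖ ^ 2)) := by gcongr
    _ = c * q.factorial * (Real.exp (1 + ‖z‖) * Real.exp (-(1 / 2) * ‖z‖ ^ 2)) := by ring
    _ ≤ c * q.factorial * (Real.exp 2 * Real.exp (-(1 / 4) * ‖z‖ ^ 2)) := by gcongr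
    _ = _ := by ring

theorem gaussianDensity_add_mulVec {d : ℕ} (m : Euc d) {A : Matrix (Fin d) (Fin d) ℝ}
    (hA : IsUnit A.det) (z : Euc d) :
    gaussianDensity m (A * Aᵀ) (m + A.toEuclideanLin z) = |A.det|⁻¹ * gaussianDensity 0 1 z := by
  unfold gaussianDensity
  have hquad : (A *ᵥ z.ofLp) ⬝ᵥ ((A * Aᵀ)⁻¹ *ᵥ (A *ᵥ z.ofLp)) = z.ofLp ⬝ᵥ z.ofLp := by
    rw [Matrix.mul_inv_rev, Matrix.mulVec_mulVec, Matrix.mul_assoc, Matrix.nonsing_inv_mul A hA,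
      Matrix.mul_one, Matrix.dotProduct_mulVec, ← Matrix.mulVec_transpose,
      Matrix.transpose_nonsing_inv, Matrix.transpose_transpose, Matrix.mulVec_mulVec,
      Matrix.nonsing_inv_mul A hA, Matrix.one_mulVec]
  have e1 : (m + A.toEuclideanLin z - m).ofLp = A *ᵥ z.ofLp := by
    rw [add_sub_cancel_left]; rfl
  rw [e1, hquad, Matrix.det_mul, Matrix.det_transpose, Matrix.det_one, inv_one, Matrix.one_mulVec,
    sub_zero, mul_one, Real.sqrt_mul (by positivity), ← sq, Real.sqrt_sq_eq_abs, mul_inv]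
  ring

theorem lintegral_comp_toEuclideanLin {d : ℕ} {A : Matrix (Fin d) (Fin d) ℝ}
    (hA : A.det ≠ 0) {F : Euc d → ℝ≥0∞} (hF : Measurable F) :
    ∫⁻ z, F (A.toEuclideanLin z) = ENNReal.ofReal |A.det⁻¹| * ∫⁻ x, F x := by
  have hdet : LinearMap.det (A.toEuclideanLin : Euc d →ₗ[ℝ] Euc d) = A.det := by
    rw [Matrix.toEuclideanLin_eq_toLin_orthonormal, LinearMap.det_toLin]
  have hT : Measurable (A.toEuclideanLin : Euc d →ₗ[ℝ] Euc d) :=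
    (LinearMap.continuous_of_finiteDimensional _).measurable
  have hmap := Measure.map_linearMap_addHaar_eq_smul_addHaar (volume : Measure (Euc d))
    (f := A.toEuclideanLin) (by rw [hdet]; exact hA)
  rw [← lintegral_map hF hT, hmap, hdet, lintegral_smul_measure, smul_eq_mul]

/-- A normal variable with mean `m` and covariance `A * Aᵀ` is `m + A z` with `z` standard. -/
theorem lintegral_mul_gaussianDensity {d : ℕ} (m : Euc d) {A : Matrix (Fin d) (Fin d) ℝ}
    (hA : IsUnit A.det) {h : Euc d → ℝ≥0∞} (hh : Measurable h) :
    ∫⁻ x, h x * ENNReal.ofReal (gaussianDensity m (A * Aᵀ) x)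
      = ∫⁻ z, h (m + A.toEuclideanLin z) * ENNReal.ofReal (gaussianDensity 0 1 z) := by
  have hdet0 : A.det ≠ 0 := hA.ne_zero
  have hGm : Measurable fun x => gaussianDensity m (A * Aᵀ) x :=
    measurable_gaussianDensity measurable_const (fun _ _ => measurable_const) measurable_id
  have hFm : Measurable fun x => h x * ENNReal.ofReal (gaussianDensity m (A * Aᵀ) x) :=
    hh.mul hGm.ennreal_ofReal
  have h1 := lintegral_comp_toEuclideanLin hdet0 (hFm.comp (measurable_const_add m))
  simp only [Function.comp_def] at h1
  rw [lintegral_add_left_eq_self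
    (fun x => h x * ENNReal.ofReal (gaussianDensity m (A * Aᵀ) x)) m] at h1
  have h2 : ∀ z, h (m + A.toEuclideanLin z) *
      ENNReal.ofReal (gaussianDensity m (A * Aᵀ) (m + A.toEuclideanLin z))
      = ENNReal.ofReal |A.det⁻¹| *
      (h (m + A.toEuclideanLin z) * ENNReal.ofReal (gaussianDensity 0 1 z)) := fun z => by
    rw [gaussianDensity_add_mulVec m hA, ENNReal.ofReal_mul (by positivity), abs_inv]
    ring
  rw [lintegral_congr h2, lintegral_const_mul' _ _ ENNReal.ofReal_ne_top] at h1
  have hne : ENNReal.ofReal |A.det⁻¹| ≠ 0 := by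
    rw [ENNReal.ofReal_ne_zero_iff]
    exact abs_pos.2 (inv_ne_zero hdet0)
  exact ((ENNReal.mul_right_inj hne ENNReal.ofReal_ne_top).1 h1).symm

/-! ### Moments of Markov chains with a transition density -/

/-- The density of the path of a Markov chain with initial density `f` and transition density
`k`. -/
noncomputable def pathWeight {E : Type*} (f : E → ℝ≥0∞) (k : E → E → ℝ≥0∞) (N : ℕ)
    (x : Fin (N + 1) → E) : ℝ≥0∞ :=
  f (x 0) * ∏ n : Fin N, k (x n.castSucc) (x n.succ)

theorem measurable_pathWeight {E : Type*} [MeasurableSpace E] {f : E → ℝ≥0∞} {k : E → E → ℝ≥0∞}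
    (hf : Measurable f) (hk : Measurable fun p : E × E => k p.1 p.2) (N : ℕ) :
    Measurable (pathWeight f k N) := by
  unfold pathWeight
  refine (hf.comp (measurable_pi_apply 0)).mul (Finset.measurable_prod _ fun n _ => ?_)
  have hp : Measurable fun x : Fin (N + 1) → E => (x n.castSucc, x n.succ) :=
    (measurable_pi_apply n.castSucc).prodMk (measurable_pi_apply n.succ)
  exact hk.comp hp

theorem pathWeight_snoc {E : Type*} (f : E → ℝ≥0∞) (k : E → E → ℝ≥0∞) (N : ℕ)
    (x : Fin (N + 1) → E) (v : E) :
    pathWeight f k (N + 1) (Fin.snoc (α := fun _ => E) x v)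
      = pathWeight f k N x * k (x (Fin.last N)) v := by
  unfold pathWeight
  rw [Fin.prod_univ_castSucc, ← mul_assoc]
  have h0 : (Fin.snoc (α := fun _ => E) x v) 0 = x 0 := by
    rw [← Fin.castSucc_zero, Fin.snoc_castSucc]
  have h1 : ∀ n : Fin N, (Fin.snoc (α := fun _ => E) x v) n.castSucc.succ = x n.succ := fun n => by
    rw [Fin.succ_castSucc, Fin.snoc_castSucc]
  simp only [h0, h1, Fin.snoc_castSucc, Fin.succ_last, Fin.snoc_last]

/-- Integration over trajectories, with the last coordinate integrated first. -/
theorem lintegral_pi_snoc {E : Type*} [MeasureSpace E] [SigmaFinite (volume : Measure E)] {N : ℕ}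
    {F : (Fin (N + 1) → E) → ℝ≥0∞} (hF : Measurable F) :
    ∫⁻ x, F x = ∫⁻ x : Fin N → E, ∫⁻ v : E, F (Fin.snoc (α := fun _ => E) x v) := by
  have hmp := (volume_preserving_piFinSuccAbove (fun _ : Fin (N + 1) => E) (Fin.last N)).symm
  rw [← hmp.lintegral_comp hF, Measure.volume_eq_prod, lintegral_prod_symm]
  · refine lintegral_congr fun x => lintegral_congr fun v => ?_
    congr 1
    exact Fin.insertNth_last' v x
  · exact (hF.comp hmp.measurable).aemeasurable

/-- Uniform moment bounds for all Markov chains with a given initial density whose transition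
densities satisfy the same growth conditions. -/
theorem exists_lintegral_pow_mul_pathWeight_le {E : Type*} [MeasureSpace E]
    [SigmaFinite (volume : Measure E)] {S f : E → ℝ≥0∞} (hS : Measurable S) (hf : Measurable f)
    (hfS : ∀ q : ℕ, ∫⁻ x, S x ^ q * f x < ∞) {C : ℕ → ℝ≥0∞} (hC : ∀ q, C q < ∞) (Q : ℕ → ℕ)
    (N : ℕ) : ∀ q : ℕ, ∃ M : ℝ≥0∞, M < ∞ ∧ ∀ k : E → E → ℝ≥0∞,
      (Measurable fun p : E × E => k p.1 p.2) → (∀ u, ∫⁻ v, k u v = 1) →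
      (∀ q u, ∫⁻ v, S v ^ q * k u v ≤ C q * S u ^ Q q) →
      ∀ n, ∫⁻ x, S (x n) ^ q * pathWeight f k N x ≤ M := by
  induction N with
  | zero =>
    intro q
    refine ⟨_, hfS q, fun k hk hk1 hkC n => ?_⟩
    have hmp := (volume_preserving_funUnique (Fin 1) E)
    have hm : Measurable fun x => S x ^ q * f x := (hS.pow_const q).mul hf
    rw [← hmp.lintegral_comp hm]
    refine le_of_eq (lintegral_congr fun x => ?_)
    rw [show n = 0 from Subsingleton.elim (α := Fin 1) n 0]
    simp [pathWeight, MeasurableEquiv.funUnique]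
  | succ N ih =>
    intro q
    obtain ⟨M₁, hM₁, h₁⟩ := ih q
    obtain ⟨M₂, hM₂, h₂⟩ := ih (Q q)
    refine ⟨max M₁ (C q * M₂), max_lt hM₁ (ENNReal.mul_lt_top (hC q) hM₂),
      fun k hk hk1 hkC n => ?_⟩
    have hkm : ∀ u, Measurable (k u) := fun u => hk.comp measurable_prodMk_left
    have hm' : Measurable fun x : Fin (N + 1 + 1) → E => S (x n) ^ q * pathWeight f k (N + 1) x :=
      ((hS.comp (measurable_pi_apply n)).pow_const q).mul (measurable_pathWeight hf hk (N + 1))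
    rw [lintegral_pi_snoc hm']
    simp_rw [pathWeight_snoc]
    -- the last coordinate contributes through `hkC`; otherwise it integrates to one
    refine Fin.lastCases ?_ (fun j => ?_) n
    · refine le_trans ?_ (le_max_right _ _)
      refine le_trans ?_ (mul_le_mul_right (h₂ k hk hk1 hkC (Fin.last N)) (C q))
      have hm : Measurable fun x : Fin (N + 1) → E =>
          S (x (Fin.last N)) ^ Q q * pathWeight f k N x :=
        ((hS.comp (measurable_pi_apply _)).pow_const _).mul (measurable_pathWeight hf hk N)
      rw [← lintegral_const_mul _ hm]
      refine lintegral_mono fun x => ?_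
      simp only [Fin.snoc_last]
      calc ∫⁻ v, S v ^ q * (pathWeight f k N x * k (x (Fin.last N)) v)
          = pathWeight f k N x * ∫⁻ v, S v ^ q * k (x (Fin.last N)) v := by
            have hm2 : Measurable fun v => S v ^ q * k (x (Fin.last N)) v :=
              (hS.pow_const q).mul (hkm _)
            rw [← lintegral_const_mul _ hm2]
            exact lintegral_congr fun v => by ring
        _ ≤ pathWeight f k N x * (C q * S (x (Fin.last N)) ^ Q q) :=
            mul_le_mul_right (hkC q _) _
        _ = _ := by ring
    · refine le_trans ?_ (le_max_left _ _)
      refine le_trans (le_of_eq ?_) (h₁ k hk hk1 hkC j)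
      refine lintegral_congr fun x => ?_
      simp only [Fin.snoc_castSucc]
      rw [lintegral_const_mul _ ((hkm _).const_mul _), lintegral_const_mul _ (hkm _), hk1, mul_one]

theorem lintegral_pathWeight {E : Type*} [MeasureSpace E]
    [SigmaFinite (volume : Measure E)] {f : E → ℝ≥0∞} (hf : Measurable f)
    (hf1 : ∫⁻ x, f x = 1) {k : E → E → ℝ≥0∞} (hk : Measurable fun p : E × E => k p.1 p.2)
    (hk1 : ∀ u, ∫⁻ v, k u v = 1) (N : ℕ) : ∫⁻ x, pathWeight f k N x = 1 := by
  induction N with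
  | zero =>
    have hmp := (volume_preserving_funUnique (Fin 1) E)
    rw [← hf1, ← hmp.lintegral_comp hf]
    refine lintegral_congr fun x => ?_
    simp [pathWeight, MeasurableEquiv.funUnique]
  | succ N ih =>
    rw [lintegral_pi_snoc (measurable_pathWeight hf hk (N + 1)), ← ih]
    refine lintegral_congr fun x => ?_
    simp_rw [pathWeight_snoc]
    have hkm : ∀ u, Measurable (k u) := fun u => hk.comp measurable_prodMk_left
    rw [lintegral_const_mul _ (hkm _), hk1, mul_one]

end EMDrift

namespace EMDrift

/-! ### The reproducing kernel Hilbert space -/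

theorem one_add_rpow_le {t κ : ℝ} (ht : 0 ≤ t) (hκ : 0 ≤ κ) : 1 + t ^ κ ≤ 2 * (1 + t) ^ κ := by
  have h1 : (1 : ℝ) ≤ (1 + t) ^ κ := Real.one_le_rpow (by linarith) hκ
  have h2 : t ^ κ ≤ (1 + t) ^ κ := Real.rpow_le_rpow ht (by linarith) hκ
  linarith

theorem tendsto_euc_of_inner {ι : Type*} {l : Filter ι} {d : ℕ} {f : ι → Euc d} {y : Euc d}
    (h : ∀ v, Tendsto (fun i => inner ℝ (f i) v) l (𝓝 (inner ℝ y v))) : Tendsto f l (𝓝 y) := by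
  have h1 : Tendsto (fun i => (f i).ofLp) l (𝓝 y.ofLp) := by
    refine tendsto_pi_nhds.2 fun j => ?_
    simpa [EuclideanSpace.inner_single_right] using h (EuclideanSpace.single j (1 : ℝ))
  exact ((PiLp.continuous_toLp 2 _).tendsto _).comp h1

section RKHS

variable {d d₀ N₀ M₀ : ℕ} {𝓜 : ObservedDiffusion d d₀ N₀ M₀}
variable {H : Type*} [NormedAddCommGroup H] [InnerProductSpace ℝ H] [CompleteSpace H]
  [RKHS ℝ H (Euc d) (Euc d)]
variable {Cσ Ca CK B s α κ : ℝ}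

/-- The kernel sections depend continuously on the base point in the norm of `H`. -/
theorem ModelAssumption.continuous_kerFun (hA : ModelAssumption (H := H) 𝓜 Cσ Ca CK B s α κ)
    (v : Euc d) : Continuous fun u => RKHS.kerFun H u v := by
  rw [continuous_iff_continuousAt]
  intro u₀
  have hsq : ∀ u, ‖RKHS.kerFun H u v - RKHS.kerFun H u₀ v‖ ^ 2
      = inner ℝ (RKHS.kernel H u u v) v - 2 * inner ℝ (RKHS.kernel H u u₀ v) v
        + inner ℝ (RKHS.kernel H u₀ u₀ v) v := fun u => by
    rw [norm_sub_sq_real, ← real_inner_self_eq_norm_sq, ← real_inner_self_eq_norm_sq,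
      RKHS.kernel_inner, RKHS.kernel_inner, RKHS.kernel_inner,
      real_inner_comm (RKHS.kerFun H u v) (RKHS.kerFun H u₀ v)]
  have hcont : Continuous fun u => inner ℝ (RKHS.kernel H u u v) v
      - 2 * inner ℝ (RKHS.kernel H u u₀ v) v + inner ℝ (RKHS.kernel H u₀ u₀ v) v := by
    have h1 := hA.kernel_continuous_diag
    have h2 := hA.kernel_continuous_left u₀
    fun_prop
  have h0 : Tendsto (fun u => ‖RKHS.kerFun H u v - RKHS.kerFun H u₀ v‖ ^ 2) (𝓝 u₀) (𝓝 0) := by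
    simp_rw [hsq]
    have := hcont.tendsto u₀
    convert this using 2
    ring
  have h3 := (Real.continuous_sqrt.tendsto 0).comp h0
  simp only [Function.comp_def, Real.sqrt_sq (norm_nonneg _), Real.sqrt_zero] at h3
  exact tendsto_iff_norm_sub_tendsto_zero.2 h3

theorem ModelAssumption.continuous_coe (hA : ModelAssumption (H := H) 𝓜 Cσ Ca CK B s α κ)
    (b : H) : Continuous (b : Euc d → Euc d) := by
  refine continuous_iff_continuousAt.2 fun u => tendsto_euc_of_inner fun v => ?_
  simp_rw [← RKHS.inner_kerFun]
  exact ((continuous_const.inner (hA.continuous_kerFun v)).tendsto u)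

theorem ModelAssumption.norm_apply_le (hA : ModelAssumption (H := H) 𝓜 Cσ Ca CK B s α κ)
    (b : H) (u : Euc d) : ‖b u‖ ≤ √(2 * CK) * ‖b‖ * (1 + ‖u‖) ^ (κ / 2) := by
  refine (RKHS.norm_apply_le b u).trans ?_
  have h1 : ‖RKHS.kernel H u u‖ ≤ (2 * CK) * (1 + ‖u‖) ^ κ := by
    refine (hA.kernel_bound u).trans ?_
    have := mul_le_mul_of_nonneg_left (one_add_rpow_le (norm_nonneg u) hA.κ_nonneg) hA.CK_nonneg
    linarith
  have h2 : √((1 + ‖u‖) ^ κ) = (1 + ‖u‖) ^ (κ / 2) := by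
    rw [Real.sqrt_eq_rpow, ← Real.rpow_mul (by positivity)]
    ring_nf
  calc ‖b‖ * √‖RKHS.kernel H u u‖ ≤ ‖b‖ * √((2 * CK) * (1 + ‖u‖) ^ κ) := by gcongr
    _ = _ := by
      rw [Real.sqrt_mul (mul_nonneg zero_le_two hA.CK_nonneg), h2]
      ring

/-- The ranges of the finitely many continuous functions `u ↦ kerFun H u eᵢ` span a dense subspace. -/
theorem ModelAssumption.separableSpace (hA : ModelAssumption (H := H) 𝓜 Cσ Ca CK B s α κ) :
    TopologicalSpace.SeparableSpace H := by
  set S : Set H := ⋃ i : Fin d, range fun u => RKHS.kerFun H u (EuclideanSpace.single i (1 : ℝ))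
    with hS
  have hSsep : TopologicalSpace.IsSeparable S :=
    TopologicalSpace.IsSeparable.iUnion fun i =>
      TopologicalSpace.isSeparable_range (hA.continuous_kerFun _)
  have hle : Submodule.span ℝ {RKHS.kerFun H x v | (x : Euc d) (v : Euc d)}
      ≤ Submodule.span ℝ S := by
    refine Submodule.span_le.2 ?_
    rintro _ ⟨x, v, rfl⟩
    have hv : v = ∑ i, v i • EuclideanSpace.single i (1 : ℝ) := by
      ext j
      simp [Finset.sum_apply, Pi.single_apply]
    rw [hv, map_sum]
    refine Submodule.sum_mem _ fun i _ => ?_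
    rw [map_smul]
    exact Submodule.smul_mem _ _ (Submodule.subset_span (mem_iUnion.2 ⟨i, x, rfl⟩))
  have htop : (Submodule.span ℝ S).topologicalClosure = ⊤ := by
    rw [eq_top_iff, ← RKHS.kerFun_dense H]
    exact Submodule.topologicalClosure_mono hle
  rw [← TopologicalSpace.isSeparable_univ_iff]
  have h := (hSsep.span (R := ℝ)).closure
  rwa [← Submodule.topologicalClosure_coe, htop, Submodule.top_coe] at h

/-- Bounded sequences in `H` have pointwise convergent subsequences, because `H` is separable. -/
theorem ModelAssumption.exists_subseq_tendsto
    (hA : ModelAssumption (H := H) 𝓜 Cσ Ca CK B s α κ) {r : ℝ} {u : ℕ → H} (hu : ∀ n, ‖u n‖ ≤ r) :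
    ∃ (b : H) (φ : ℕ → ℕ), StrictMono φ ∧ ∀ x, Tendsto (fun n => u (φ n) x) atTop (𝓝 (b x)) := by
  have hsep : TopologicalSpace.SeparableSpace H := hA.separableSpace
  obtain ⟨ψ, -, φ, hφ, hlim⟩ := WeakDual.isSeqCompact_closedBall ℝ H 0 r
    (x := fun n => StrongDual.toWeakDual (InnerProductSpace.toDual ℝ H (u n))) (fun n => by
      rw [mem_preimage, mem_closedBall_zero_iff]
      exact ((InnerProductSpace.toDual ℝ H).norm_map (u n)).trans_le (hu n))
  refine ⟨(InnerProductSpace.toDual ℝ H).symm (WeakDual.toStrongDual ψ), φ, hφ, fun x => ?_⟩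
  have hw : ∀ h : H, Tendsto (fun n => inner ℝ (u (φ n)) h) atTop (𝓝 (ψ h)) := fun h =>
    ((WeakDual.eval_continuous h).tendsto ψ).comp hlim
  refine tendsto_euc_of_inner fun v => ?_
  simp_rw [← RKHS.inner_kerFun]
  have h1 := hw (RKHS.kerFun H x v)
  rwa [InnerProductSpace.toDual_symm_apply]

end RKHS

/-! ### Moments of the latent trajectory -/

namespace ObservedDiffusion

variable {d d₀ N₀ M₀ : ℕ} (𝓜 : ObservedDiffusion d d₀ N₀ M₀)

theorem measurable_a (i j : Fin d) : Measurable fun x => 𝓜.a x i j := by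
  simp only [a, Matrix.mul_apply, Matrix.transpose_apply]
  exact Finset.measurable_sum _ fun k _ => (𝓜.σ_measurable i k).mul (𝓜.σ_measurable j k)

theorem measurable_transition {b : Euc d → Euc d} (hb : Measurable b) :
    Measurable fun p : Euc d × Euc d =>
      gaussianDensity (p.1 + 𝓜.Δ • b p.1) (𝓜.Δ • 𝓜.a p.1) p.2 := by
  refine measurable_gaussianDensity (by fun_prop) (fun i j => ?_) measurable_snd
  simp only [Matrix.smul_apply, smul_eq_mul]
  exact ((𝓜.measurable_a i j).comp measurable_fst).const_mul _

theorem pathDensity_nonneg (b : Euc d → Euc d) (x : Path d N₀) : 0 ≤ 𝓜.pathDensity b x :=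
  mul_nonneg (𝓜.f₀_nonneg _) (Finset.prod_nonneg fun _ _ => gaussianDensity_nonneg _ _ _)

theorem measurable_comp_step {T : Euc d → Euc d → ℝ}
    (hT : Measurable fun p : Euc d × Euc d => T p.1 p.2) (n : Fin N₀) :
    Measurable fun x : Path d N₀ => T (x n.castSucc) (x n.succ) := by
  have hp : Measurable fun x : Path d N₀ => (x n.castSucc, x n.succ) :=
    (measurable_pi_apply n.castSucc).prodMk (measurable_pi_apply n.succ)
  exact hT.comp hp

theorem measurable_pathDensity {b : Euc d → Euc d} (hb : Measurable b) :
    Measurable (𝓜.pathDensity b) := by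
  have h0 : Measurable fun x : Path d N₀ => 𝓜.f₀ (x 0) :=
    𝓜.f₀_measurable.comp (measurable_pi_apply 0)
  exact h0.mul (Finset.measurable_fun_prod _ fun n _ =>
    measurable_comp_step (T := fun u v => gaussianDensity (u + 𝓜.Δ • b u) (𝓜.Δ • 𝓜.a u) v)
      (𝓜.measurable_transition hb) n)

theorem ofReal_pathDensity (b : Euc d → Euc d) (x : Path d N₀) :
    ENNReal.ofReal (𝓜.pathDensity b x) = pathWeight (fun u => ENNReal.ofReal (𝓜.f₀ u))
      (fun u v => ENNReal.ofReal (gaussianDensity (u + 𝓜.Δ • b u) (𝓜.Δ • 𝓜.a u) v)) N₀ x := by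
  unfold pathDensity pathWeight
  rw [ENNReal.ofReal_mul (𝓜.f₀_nonneg _),
    ENNReal.ofReal_prod_of_nonneg fun _ _ => gaussianDensity_nonneg _ _ _]

variable {𝓜}

theorem smul_a_eq (u : Euc d) :
    𝓜.Δ • 𝓜.a u = (√𝓜.Δ • 𝓜.σ u) * (√𝓜.Δ • 𝓜.σ u)ᵀ := by
  rw [a, Matrix.transpose_smul, Matrix.smul_mul, Matrix.mul_smul, smul_smul,
    Real.mul_self_sqrt 𝓜.Δ_pos.le]

theorem isUnit_det_smul_σ {u : Euc d} (ha : IsUnit (𝓜.a u)) :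
    IsUnit (√𝓜.Δ • 𝓜.σ u).det := by
  have h1 : IsUnit (𝓜.Δ • 𝓜.a u).det := by
    rw [Matrix.det_smul]
    exact (IsUnit.mk0 _ (pow_ne_zero _ 𝓜.Δ_pos.ne')).mul ((Matrix.isUnit_iff_isUnit_det _).1 ha)
  rw [smul_a_eq, Matrix.det_mul] at h1
  exact isUnit_of_mul_isUnit_left h1

theorem lintegral_mul_transition (b : Euc d → Euc d) {u : Euc d} (ha : IsUnit (𝓜.a u))
    {h : Euc d → ℝ≥0∞} (hh : Measurable h) :
    ∫⁻ v, h v * ENNReal.ofReal (gaussianDensity (u + 𝓜.Δ • b u) (𝓜.Δ • 𝓜.a u) v)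
      = ∫⁻ z, h (u + 𝓜.Δ • b u + (√𝓜.Δ • 𝓜.σ u).toEuclideanLin z)
        * ENNReal.ofReal (gaussianDensity 0 1 z) := by
  rw [smul_a_eq]
  exact lintegral_mul_gaussianDensity _ (isUnit_det_smul_σ ha) hh

theorem lintegral_transition (b : Euc d → Euc d) {u : Euc d} (ha : IsUnit (𝓜.a u)) :
    ∫⁻ v, ENNReal.ofReal (gaussianDensity (u + 𝓜.Δ • b u) (𝓜.Δ • 𝓜.a u) v) = 1 := by
  have h := lintegral_mul_transition b ha (h := fun _ => 1) measurable_const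
  simpa only [one_mul, lintegral_gaussianDensity_zero_one] using h

theorem lintegral_pathDensity (ha : ∀ u, IsUnit (𝓜.a u)) {b : Euc d → Euc d}
    (hb : Measurable b) : ∫⁻ x : Path d N₀, ENNReal.ofReal (𝓜.pathDensity b x) = 1 := by
  simp_rw [ofReal_pathDensity]
  exact lintegral_pathWeight 𝓜.f₀_measurable.ennreal_ofReal 𝓜.f₀_lintegral
    (𝓜.measurable_transition hb).ennreal_ofReal (fun u => lintegral_transition b (ha u)) N₀

theorem integrable_pathDensity (ha : ∀ u, IsUnit (𝓜.a u)) {b : Euc d → Euc d}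
    (hb : Measurable b) : Integrable (fun x : Path d N₀ => 𝓜.pathDensity b x) :=
  (lintegral_ofReal_ne_top_iff_integrable (𝓜.measurable_pathDensity hb).aestronglyMeasurable
    (Eventually.of_forall (𝓜.pathDensity_nonneg b))).1
    (by rw [lintegral_pathDensity ha hb]; exact ENNReal.one_ne_top)

theorem integral_pathDensity (ha : ∀ u, IsUnit (𝓜.a u)) {b : Euc d → Euc d}
    (hb : Measurable b) : ∫ x : Path d N₀, 𝓜.pathDensity b x = 1 := by
  rw [integral_eq_lintegral_of_nonneg_ae (Eventually.of_forall (𝓜.pathDensity_nonneg b))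
    (𝓜.measurable_pathDensity hb).aestronglyMeasurable, lintegral_pathDensity ha hb]
  rfl

theorem lintegral_pow_mul_f₀_lt_top
    (hf₀ : ∀ q : ℝ, 0 < q → ∫⁻ x, ENNReal.ofReal (‖x‖ ^ q * 𝓜.f₀ x) < ∞) (q : ℕ) :
    ∫⁻ x, ENNReal.ofReal (1 + ‖x‖) ^ q * ENNReal.ofReal (𝓜.f₀ x) < ∞ := by
  have h1 : ∀ x, ENNReal.ofReal (1 + ‖x‖) ^ q * ENNReal.ofReal (𝓜.f₀ x) ≤
      ENNReal.ofReal (2 ^ q) * (ENNReal.ofReal (𝓜.f₀ x)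
        + ENNReal.ofReal (‖x‖ ^ ((q + 1 : ℕ) : ℝ) * 𝓜.f₀ x)) := fun x => by
    have hf := 𝓜.f₀_nonneg x
    rw [← ENNReal.ofReal_pow (by positivity), ← ENNReal.ofReal_mul (by positivity),
      ← ENNReal.ofReal_add hf (by positivity), ← ENNReal.ofReal_mul (by positivity),
      Real.rpow_natCast]
    refine ENNReal.ofReal_le_ofReal ?_
    have h2 : (1 + ‖x‖) ^ q ≤ 2 ^ q * (1 + ‖x‖ ^ (q + 1)) := by
      have h3 := add_pow_le zero_le_one (norm_nonneg x) (q + 1)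
      have h4 : (1 + ‖x‖) ^ q ≤ (1 + ‖x‖) ^ (q + 1) :=
        pow_le_pow_right₀ (by linarith [norm_nonneg x]) (Nat.le_succ q)
      simpa using h4.trans h3
    calc (1 + ‖x‖) ^ q * 𝓜.f₀ x ≤ 2 ^ q * (1 + ‖x‖ ^ (q + 1)) * 𝓜.f₀ x := by gcongr
      _ = _ := by ring
  refine lt_of_le_of_lt (lintegral_mono h1) ?_
  rw [lintegral_const_mul' _ _ ENNReal.ofReal_ne_top,
    lintegral_add_left 𝓜.f₀_measurable.ennreal_ofReal, 𝓜.f₀_lintegral]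
  exact ENNReal.mul_lt_top ENNReal.ofReal_lt_top
    (ENNReal.add_lt_top.2 ⟨ENNReal.one_lt_top, hf₀ _ (by positivity)⟩)

/-- One step of the chain: moments are controlled when drift and diffusion coefficient grow at
most polynomially. -/
theorem lintegral_pow_mul_transition_le {b : Euc d → Euc d} (ha : ∀ u, IsUnit (𝓜.a u))
    {C : ℝ} {j : ℕ} (hb : ∀ u, ‖b u‖ ≤ C * (1 + ‖u‖) ^ j)
    (hσ : ∀ u, ‖𝓜.σ u‖ ≤ C * (1 + ‖u‖) ^ j) (q : ℕ) (u : Euc d) :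
    ∫⁻ v, ENNReal.ofReal (1 + ‖v‖) ^ q *
        ENNReal.ofReal (gaussianDensity (u + 𝓜.Δ • b u) (𝓜.Δ • 𝓜.a u) v)
      ≤ ENNReal.ofReal ((1 + 𝓜.Δ * C + √𝓜.Δ * C) ^ q) *
        (∫⁻ z : Euc d, ENNReal.ofReal ((1 + ‖z‖) ^ q * gaussianDensity 0 1 z))
        * ENNReal.ofReal (1 + ‖u‖) ^ ((j + 1) * q) := by
  have hC : 0 ≤ C := by
    have := (norm_nonneg _).trans (hb 0)
    simpa using this
  have hΔ := 𝓜.Δ_pos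
  rw [lintegral_mul_transition b (ha u) (by fun_prop), ← ENNReal.ofReal_pow (by positivity),
    mul_right_comm, ← ENNReal.ofReal_mul (by positivity),
    ← lintegral_const_mul' _ _ ENNReal.ofReal_ne_top]
  refine lintegral_mono fun z => ?_
  rw [← ENNReal.ofReal_pow (by positivity), ← ENNReal.ofReal_mul (by positivity),
    ← ENNReal.ofReal_mul (by positivity)]
  refine ENNReal.ofReal_le_ofReal ?_
  rw [← mul_assoc]
  refine mul_le_mul_of_nonneg_right ?_ (gaussianDensity_nonneg _ _ _)
  rw [pow_mul, ← mul_pow, ← mul_pow]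
  refine pow_le_pow_left₀ (by positivity) ?_ q
  set t := ‖u‖ with ht
  have ht0 : 0 ≤ t := norm_nonneg u
  have hone : (1 : ℝ) ≤ (1 + t) ^ j := one_le_pow₀ (by linarith)
  have hT : ‖(√𝓜.Δ • 𝓜.σ u).toEuclideanLin z‖ ≤ √𝓜.Δ * (C * (1 + t) ^ j) * ‖z‖ := by
    have h1 := (√𝓜.Δ • 𝓜.σ u).l2_opNorm_mulVec z
    rw [norm_smul, Real.norm_of_nonneg (Real.sqrt_nonneg _)] at h1
    refine (le_trans (le_of_eq ?_) h1).trans ?_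
    · rfl
    · gcongr
      exact hσ u
  have hB : ‖𝓜.Δ • b u‖ ≤ 𝓜.Δ * (C * (1 + t) ^ j) := by
    rw [norm_smul, Real.norm_of_nonneg hΔ.le]
    gcongr
    exact hb u
  have h3 := norm_add₃_le (a := u) (b := 𝓜.Δ • b u) (c := (√𝓜.Δ • 𝓜.σ u).toEuclideanLin z)
  set P := (1 + t) ^ j
  set A := 𝓜.Δ * C
  set D := √𝓜.Δ * C
  have hA0 : 0 ≤ A := by positivity
  have hD0 : 0 ≤ D := by positivity
  have hz := norm_nonneg z
  have e : (1 + t) ^ (j + 1) = P * (1 + t) := pow_succ _ _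
  rw [e]
  have hT' : ‖(√𝓜.Δ • 𝓜.σ u).toEuclideanLin z‖ ≤ D * P * ‖z‖ := hT.trans_eq (by ring)
  have hB' : ‖𝓜.Δ • b u‖ ≤ A * P := hB.trans_eq (by ring)
  have f1 : 1 + t ≤ P * (1 + t) := le_mul_of_one_le_left (by linarith) hone
  have f2 : P ≤ P * (1 + t) := le_mul_of_one_le_right (by linarith) (by linarith)
  set G := P * (1 + t)
  have f3 : A * P ≤ A * G := by gcongr
  have f4 : D * P * ‖z‖ ≤ D * G * ‖z‖ := by gcongr
  have hG : 0 ≤ G := by linarith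
  have f5 : 0 ≤ G * ‖z‖ + A * G * ‖z‖ + D * G := by positivity
  calc 1 + ‖u + 𝓜.Δ • b u + (√𝓜.Δ • 𝓜.σ u).toEuclideanLin z‖
      ≤ G + A * G + D * G * ‖z‖ := by linarith
    _ ≤ (1 + A + D) * G * (1 + ‖z‖) := by nlinarith

end ObservedDiffusion

section RKHS

variable {d d₀ N₀ M₀ : ℕ} {𝓜 : ObservedDiffusion d d₀ N₀ M₀}
variable {H : Type*} [NormedAddCommGroup H] [InnerProductSpace ℝ H] [CompleteSpace H]
  [RKHS ℝ H (Euc d) (Euc d)]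
variable {Cσ Ca CK B s α κ : ℝ}

theorem rpow_le_pow_of_le {t κ : ℝ} {j : ℕ} (ht : 0 ≤ t) (h : κ ≤ j) :
    (1 + t) ^ κ ≤ (1 + t) ^ j := by
  rw [← Real.rpow_natCast]
  exact Real.rpow_le_rpow_of_exponent_le (by linarith) h

/-- All moments of the latent trajectory are bounded, uniformly over bounded sets of drifts. -/
theorem ModelAssumption.exists_moment_bound (hA : ModelAssumption (H := H) 𝓜 Cσ Ca CK B s α κ)
    (hf₀ : ∀ q : ℝ, 0 < q → ∫⁻ x, ENNReal.ofReal (‖x‖ ^ q * 𝓜.f₀ x) < ∞) (r : ℝ) (q : ℕ) :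
    ∃ M : ℝ, ∀ b : H, ‖b‖ ≤ r →
      ∫⁻ x : Path d N₀, ENNReal.ofReal ((1 + ‖x‖) ^ q * 𝓜.pathDensity b x) ≤ ENNReal.ofReal M := by
  -- drift and diffusion coefficient are both bounded by `C * (1 + ‖u‖) ^ j`
  obtain ⟨j, hj⟩ := exists_nat_ge (max (κ / 2) s)
  set C := max (√(2 * CK) * r) (2 * Cσ) with hC
  obtain ⟨M, hM, hMb⟩ := exists_lintegral_pow_mul_pathWeight_le
    (S := fun u : Euc d => ENNReal.ofReal (1 + ‖u‖)) (f := fun u => ENNReal.ofReal (𝓜.f₀ u))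
    (by fun_prop) 𝓜.f₀_measurable.ennreal_ofReal
    (ObservedDiffusion.lintegral_pow_mul_f₀_lt_top hf₀)
    (C := fun q => ENNReal.ofReal ((1 + 𝓜.Δ * C + √𝓜.Δ * C) ^ q) *
        (∫⁻ z : Euc d, ENNReal.ofReal ((1 + ‖z‖) ^ q * gaussianDensity 0 1 z)))
    (fun q => ENNReal.mul_lt_top ENNReal.ofReal_lt_top
      (lintegral_pow_mul_gaussianDensity_zero_one_lt_top d q)) (fun q => (j + 1) * q) N₀ q
  refine ⟨((N₀ + 1 : ℕ) * M).toReal, fun b hb => ?_⟩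
  rw [ENNReal.ofReal_toReal (ENNReal.mul_ne_top (ENNReal.natCast_ne_top _) hM.ne)]
  have hbm : Measurable (b : Euc d → Euc d) := (hA.continuous_coe b).measurable
  have hbC : ∀ u, ‖b u‖ ≤ C * (1 + ‖u‖) ^ j := fun u => by
    refine (hA.norm_apply_le b u).trans ?_
    have h1 := rpow_le_pow_of_le (norm_nonneg u) ((le_max_left _ _).trans hj)
    have h2 : √(2 * CK) * ‖b‖ ≤ C :=
      (mul_le_mul_of_nonneg_left hb (Real.sqrt_nonneg _)).trans (le_max_left _ _)
    have h3 : 0 ≤ √(2 * CK) * ‖b‖ := by positivity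
    gcongr
    exact h3.trans h2
  have hσC : ∀ u, ‖𝓜.σ u‖ ≤ C * (1 + ‖u‖) ^ j := fun u => by
    refine (hA.σ_bound u).trans ?_
    have h1 := rpow_le_pow_of_le (norm_nonneg u) ((le_max_right _ _).trans hj)
    have h2 := one_add_rpow_le (norm_nonneg u) hA.s_nonneg
    have h3 := hA.Cσ_nonneg
    calc Cσ * (1 + ‖u‖ ^ s) ≤ Cσ * (2 * (1 + ‖u‖) ^ j) := by gcongr; linarith
      _ = 2 * Cσ * (1 + ‖u‖) ^ j := by ring
      _ ≤ _ := by gcongr; exact le_max_right _ _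
  have key := hMb (fun u v => ENNReal.ofReal
      (gaussianDensity (u + 𝓜.Δ • b u) (𝓜.Δ • 𝓜.a u) v))
    (𝓜.measurable_transition hbm).ennreal_ofReal
    (fun u => ObservedDiffusion.lintegral_transition b (hA.a_isUnit u))
    (fun q u => ObservedDiffusion.lintegral_pow_mul_transition_le hA.a_isUnit hbC hσC q u)
  have hpt : ∀ x : Path d N₀, ENNReal.ofReal ((1 + ‖x‖) ^ q * 𝓜.pathDensity b x) ≤
      ∑ n, ENNReal.ofReal (1 + ‖x n‖) ^ q * pathWeight (fun u => ENNReal.ofReal (𝓜.f₀ u))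
      (fun u v => ENNReal.ofReal (gaussianDensity (u + 𝓜.Δ • b u) (𝓜.Δ • 𝓜.a u) v)) N₀ x := by
    intro x
    obtain ⟨n, hn⟩ := Finite.exists_max fun n => ‖x n‖
    have hx : ‖x‖ ≤ ‖x n‖ := (pi_norm_le_iff_of_nonneg (norm_nonneg _)).2 hn
    rw [ENNReal.ofReal_mul (by positivity), ENNReal.ofReal_pow (by positivity),
      𝓜.ofReal_pathDensity, ← Finset.sum_mul]
    gcongr
    refine le_trans ?_ (Finset.single_le_sum (fun _ _ => zero_le) (Finset.mem_univ n))
    gcongr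
  refine (lintegral_mono hpt).trans ?_
  rw [lintegral_finsetSum]
  · refine (Finset.sum_le_card_nsmul _ _ M fun n _ => key n).trans ?_
    simp
  · intro n _
    refine Measurable.mul (by fun_prop) (measurable_pathWeight 𝓜.f₀_measurable.ennreal_ofReal
      (𝓜.measurable_transition hbm).ennreal_ofReal N₀)

end RKHS

end EMDrift

namespace EMDrift

/-! ### The quadratic form of the log-likelihood -/

namespace ObservedDiffusion

variable {d d₀ N₀ M₀ : ℕ} (𝓜 : ObservedDiffusion d d₀ N₀ M₀)

/-- The bilinear form `∑ₙ fₙᵀ a(xₙ)⁻¹ gₙ` along a trajectory `x`. -/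
noncomputable def stepForm (x : Path d N₀) (f g : Fin N₀ → Euc d) : ℝ :=
  ∑ n, (f n).ofLp ⬝ᵥ ((𝓜.a (x n.castSucc))⁻¹ *ᵥ (g n).ofLp)

/-- The increments of a trajectory. -/
def incr {d N : ℕ} (x : Path d N) : Fin N → Euc d := fun n => x n.succ - x n.castSucc

/-- The values of the drift `b` along a trajectory, at the times that start a step. -/
def drift {d N : ℕ} (b : Euc d → Euc d) (x : Path d N) : Fin N → Euc d :=
  fun n => b (x n.castSucc)

/-- The part of the negative log-likelihood of a trajectory that depends on the drift. -/
noncomputable def energy (b : Euc d → Euc d) (x : Path d N₀) : ℝ :=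
  (2 * 𝓜.Δ)⁻¹ * 𝓜.stepForm x (incr x - 𝓜.Δ • drift b x) (incr x - 𝓜.Δ • drift b x)

variable {𝓜}

theorem stepForm_add_left (x : Path d N₀) (f f' g : Fin N₀ → Euc d) :
    𝓜.stepForm x (f + f') g = 𝓜.stepForm x f g + 𝓜.stepForm x f' g := by
  simp [stepForm, add_dotProduct, Finset.sum_add_distrib]

theorem stepForm_smul_left (x : Path d N₀) (c : ℝ) (f g : Fin N₀ → Euc d) :
    𝓜.stepForm x (c • f) g = c * 𝓜.stepForm x f g := by
  simp [stepForm, smul_dotProduct, Finset.mul_sum]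

theorem stepForm_comm (x : Path d N₀) (f g : Fin N₀ → Euc d) :
    𝓜.stepForm x f g = 𝓜.stepForm x g f := by
  refine Finset.sum_congr rfl fun n _ => ?_
  have hT : ((𝓜.a (x n.castSucc))⁻¹)ᵀ = (𝓜.a (x n.castSucc))⁻¹ := by
    rw [Matrix.transpose_nonsing_inv, a, Matrix.transpose_mul, Matrix.transpose_transpose]
  rw [Matrix.dotProduct_mulVec, ← Matrix.mulVec_transpose, hT, dotProduct_comm]

theorem stepForm_add_right (x : Path d N₀) (f g g' : Fin N₀ → Euc d) :
    𝓜.stepForm x f (g + g') = 𝓜.stepForm x f g + 𝓜.stepForm x f g' := by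
  rw [stepForm_comm, stepForm_add_left, stepForm_comm, stepForm_comm x g']

theorem stepForm_smul_right (x : Path d N₀) (c : ℝ) (f g : Fin N₀ → Euc d) :
    𝓜.stepForm x f (c • g) = c * 𝓜.stepForm x f g := by
  rw [stepForm_comm, stepForm_smul_left, stepForm_comm]

theorem stepForm_self_nonneg (x : Path d N₀) (f : Fin N₀ → Euc d) : 0 ≤ 𝓜.stepForm x f f := by
  refine Finset.sum_nonneg fun n _ => ?_
  set A := 𝓜.σ (x n.castSucc)
  have h : (𝓜.a (x n.castSucc))⁻¹ = (A⁻¹)ᵀ * A⁻¹ := by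
    rw [a, Matrix.mul_inv_rev, Matrix.transpose_nonsing_inv]
  rw [h, ← Matrix.mulVec_mulVec, Matrix.dotProduct_mulVec, ← Matrix.mulVec_transpose,
    Matrix.transpose_transpose]
  exact Finset.sum_nonneg fun i _ => mul_self_nonneg _

theorem abs_stepForm_le {x : Path d N₀} {f g : Fin N₀ → Euc d} {F G A : ℝ}
    (hf : ∀ n, ‖f n‖ ≤ F) (hg : ∀ n, ‖g n‖ ≤ G) (hA : ∀ n : Fin N₀, ‖(𝓜.a (x n.castSucc))⁻¹‖ ≤ A) :
    |𝓜.stepForm x f g| ≤ N₀ * (F * (A * G)) := by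
  refine (Finset.abs_sum_le_sum_abs _ _).trans ?_
  refine (Finset.sum_le_card_nsmul _ _ (F * (A * G)) fun n _ => ?_).trans_eq (by simp)
  have h1 := abs_real_inner_le_norm (WithLp.toLp 2 ((𝓜.a (x n.castSucc))⁻¹ *ᵥ (g n).ofLp)) (f n)
  have h2 := (𝓜.a (x n.castSucc))⁻¹.l2_opNorm_mulVec (g n)
  have h3 : inner ℝ (WithLp.toLp 2 ((𝓜.a (x n.castSucc))⁻¹ *ᵥ (g n).ofLp) : Euc d) (f n)
      = (f n).ofLp ⬝ᵥ ((𝓜.a (x n.castSucc))⁻¹ *ᵥ (g n).ofLp) := by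
    rw [EuclideanSpace.inner_eq_star_dotProduct]
    simp
  rw [h3] at h1
  refine h1.trans ?_
  rw [mul_comm]
  have hF : 0 ≤ F := (norm_nonneg _).trans (hf n)
  have hA0 : 0 ≤ A := (norm_nonneg _).trans (hA n)
  refine mul_le_mul (hf n) (h2.trans ?_) (norm_nonneg _) hF
  exact mul_le_mul (hA n) (hg n) (norm_nonneg _) hA0

theorem measurable_stepForm {f g : Path d N₀ → Fin N₀ → Euc d} (hf : ∀ n, Measurable fun x => f x n)
    (hg : ∀ n, Measurable fun x => g x n) : Measurable fun x => 𝓜.stepForm x (f x) (g x) := by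
  unfold stepForm
  refine Finset.measurable_fun_sum _ fun n _ => ?_
  refine measurable_dotProduct_mulVec (fun i j => ?_) (hf n) (hg n)
  exact (measurable_matrix_inv 𝓜.measurable_a i j).comp (measurable_pi_apply n.castSucc)

theorem measurable_incr (n : Fin N₀) : Measurable fun x : Path d N₀ => incr x n :=
  (measurable_pi_apply n.succ).sub (measurable_pi_apply n.castSucc)

theorem measurable_drift {b : Euc d → Euc d} (hb : Measurable b) (n : Fin N₀) :
    Measurable fun x : Path d N₀ => drift b x n :=
  hb.comp (measurable_pi_apply n.castSucc)

theorem energy_nonneg (b : Euc d → Euc d) (x : Path d N₀) : 0 ≤ 𝓜.energy b x :=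
  mul_nonneg (inv_nonneg.2 (mul_nonneg zero_le_two 𝓜.Δ_pos.le)) (stepForm_self_nonneg _ _)

/-- The exact second order expansion of the energy. -/
theorem energy_add (b h : Euc d → Euc d) (x : Path d N₀) :
    𝓜.energy (b + h) x = 𝓜.energy b x - 𝓜.stepForm x (incr x) (drift h x)
      + 𝓜.Δ * 𝓜.stepForm x (drift b x) (drift h x)
      + 𝓜.Δ / 2 * 𝓜.stepForm x (drift h x) (drift h x) := by
  have hΔ := 𝓜.Δ_pos.ne'
  unfold energy
  set D := incr x - 𝓜.Δ • drift b x with hD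
  have e : incr x - 𝓜.Δ • drift (b + h) x = D + (-𝓜.Δ) • drift h x := by
    ext n : 1
    simp only [hD, drift, Pi.sub_apply, Pi.add_apply, Pi.smul_apply]
    module
  have e2 : incr x = D + 𝓜.Δ • drift b x := by rw [hD]; abel
  rw [e]
  conv_rhs => rw [e2]
  simp only [stepForm_add_left, stepForm_add_right, stepForm_smul_left, stepForm_smul_right]
  rw [stepForm_comm x (drift h x) D]
  field_simp
  ring

theorem energy_eq (b : Euc d → Euc d) (x : Path d N₀) :
    𝓜.energy b x = (2 * 𝓜.Δ)⁻¹ * 𝓜.stepForm x (incr x) (incr x)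
      - 𝓜.stepForm x (incr x) (drift b x)
      + 𝓜.Δ / 2 * 𝓜.stepForm x (drift b x) (drift b x) := by
  have h := energy_add (𝓜 := 𝓜) 0 b x
  have h0 : drift (0 : Euc d → Euc d) x = 0 := rfl
  have h1 : 𝓜.stepForm x 0 (drift b x) = 0 := by
    simpa using stepForm_smul_left (𝓜 := 𝓜) x 0 0 (drift b x)
  rw [zero_add, h0, h1, mul_zero, add_zero] at h
  rw [h, energy, h0, smul_zero, sub_zero]

/-- The density of a trajectory is a factor that does not depend on the drift times
`exp (-energy)`. -/
theorem pathDensity_eq (ha : ∀ u, IsUnit (𝓜.a u)) (b : Euc d → Euc d) (x : Path d N₀) :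
    𝓜.pathDensity b x = 𝓜.f₀ (x 0) *
      (∏ n : Fin N₀, (√((2 * Real.pi) ^ d * (𝓜.Δ • 𝓜.a (x n.castSucc)).det))⁻¹)
        * Real.exp (-𝓜.energy b x) := by
  have hΔ := 𝓜.Δ_pos.ne'
  unfold pathDensity gaussianDensity
  rw [Finset.prod_mul_distrib, ← Real.exp_sum, mul_assoc]
  congr 3
  rw [energy, stepForm, Finset.mul_sum, ← Finset.sum_neg_distrib]
  refine Finset.sum_congr rfl fun n _ => ?_
  have hinv : (𝓜.Δ • 𝓜.a (x n.castSucc))⁻¹ = 𝓜.Δ⁻¹ • (𝓜.a (x n.castSucc))⁻¹ := by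
    have hu := (Matrix.isUnit_iff_isUnit_det _).1 (ha (x n.castSucc))
    exact Matrix.inv_smul' _ (Units.mk0 _ hΔ) hu
  have e : x n.succ - (x n.castSucc + 𝓜.Δ • b (x n.castSucc))
      = (incr x - 𝓜.Δ • drift b x) n := by
    simp only [incr, drift, Pi.sub_apply, Pi.smul_apply]
    abel
  rw [hinv, e, Matrix.smul_mulVec, dotProduct_smul, smul_eq_mul]
  field_simp

theorem pathDensity_eq_mul_exp (ha : ∀ u, IsUnit (𝓜.a u)) (b b' : Euc d → Euc d)
    (x : Path d N₀) :
    𝓜.pathDensity b' x = 𝓜.pathDensity b x * Real.exp (𝓜.energy b x - 𝓜.energy b' x) := by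
  rw [pathDensity_eq ha, pathDensity_eq ha b, mul_assoc _ (Real.exp _), ← Real.exp_add]
  congr 2
  ring

end ObservedDiffusion

open ObservedDiffusion

section Linearity

variable {d N : ℕ} {H : Type*} [NormedAddCommGroup H] [InnerProductSpace ℝ H]
  [RKHS ℝ H (Euc d) (Euc d)]

theorem drift_add (b b' : H) (x : Path d N) : drift (b + b' : H) x = drift b x + drift b' x := by
  ext n : 1
  simp [drift]

theorem drift_smul (c : ℝ) (b : H) (x : Path d N) : drift (c • b : H) x = c • drift b x := by
  ext n : 1
  simp [drift]

end Linearity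

section RKHS

variable {d d₀ N₀ M₀ : ℕ} {𝓜 : ObservedDiffusion d d₀ N₀ M₀}
variable {H : Type*} [NormedAddCommGroup H] [InnerProductSpace ℝ H] [CompleteSpace H]
  [RKHS ℝ H (Euc d) (Euc d)]
variable {Cσ Ca CK B s α κ : ℝ}

/-- The weight `(1 + ‖x‖) ^ (2 max(κ, 1) + α)` on trajectories; it dominates the terms of the
log-likelihood that involve the drift. -/
noncomputable def growthWeight (κ α : ℝ) {d N : ℕ} (x : Path d N) : ℝ :=
  (1 + ‖x‖) ^ (2 * max κ 1 + α)

theorem growthWeight_nonneg (κ α : ℝ) {d N : ℕ} (x : Path d N) : 0 ≤ growthWeight κ α x := by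
  unfold growthWeight
  positivity

theorem measurable_growthWeight (κ α : ℝ) {d N : ℕ} :
    Measurable (growthWeight κ α : Path d N → ℝ) := by
  unfold growthWeight
  fun_prop

theorem norm_incr_le (κ : ℝ) (x : Path d N₀) (n : Fin N₀) :
    ‖incr x n‖ ≤ 2 * (1 + ‖x‖) ^ max κ 1 := by
  have h1 : (1 + ‖x‖) ≤ (1 + ‖x‖) ^ max κ 1 := by
    conv_lhs => rw [← Real.rpow_one (1 + ‖x‖)]
    exact Real.rpow_le_rpow_of_exponent_le (by linarith [norm_nonneg x]) (le_max_right _ _)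
  have h2 := norm_sub_le (x n.succ) (x n.castSucc)
  have h3 := norm_le_pi_norm x n.succ
  have h4 := norm_le_pi_norm x n.castSucc
  simp only [incr]
  linarith

theorem ModelAssumption.norm_drift_le (hA : ModelAssumption (H := H) 𝓜 Cσ Ca CK B s α κ) (b : H)
    (x : Path d N₀) (n : Fin N₀) : ‖drift b x n‖ ≤ √(2 * CK) * ‖b‖ * (1 + ‖x‖) ^ max κ 1 := by
  refine (hA.norm_apply_le b _).trans ?_
  have hκ := hA.κ_nonneg
  have h1 : (1 + ‖x n.castSucc‖) ^ (κ / 2) ≤ (1 + ‖x‖) ^ (κ / 2) :=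
    Real.rpow_le_rpow (by positivity) (by linarith [norm_le_pi_norm x n.castSucc]) (by positivity)
  have h2 : (1 + ‖x‖) ^ (κ / 2) ≤ (1 + ‖x‖) ^ max κ 1 :=
    Real.rpow_le_rpow_of_exponent_le (by linarith [norm_nonneg x])
      (by linarith [le_max_left κ 1])
  exact mul_le_mul_of_nonneg_left (h1.trans h2) (by positivity)

theorem ModelAssumption.abs_stepForm_le_growthWeight
    (hA : ModelAssumption (H := H) 𝓜 Cσ Ca CK B s α κ) {x : Path d N₀} {f g : Fin N₀ → Euc d}
    {F G : ℝ} (hf : ∀ n, ‖f n‖ ≤ F * (1 + ‖x‖) ^ max κ 1)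
    (hg : ∀ n, ‖g n‖ ≤ G * (1 + ‖x‖) ^ max κ 1) :
    |𝓜.stepForm x f g| ≤ 2 * N₀ * Ca * F * G * growthWeight κ α x := by
  have hpos : 0 < 1 + ‖x‖ := by positivity
  have hinv : ∀ n : Fin N₀, ‖(𝓜.a (x n.castSucc))⁻¹‖ ≤ 2 * Ca * (1 + ‖x‖) ^ α := fun n => by
    refine (hA.a_inv_bound _).trans ?_
    have h1 := one_add_rpow_le (norm_nonneg (x n.castSucc)) hA.α_nonneg
    have h2 : (1 + ‖x n.castSucc‖) ^ α ≤ (1 + ‖x‖) ^ α :=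
      Real.rpow_le_rpow (by positivity) (by linarith [norm_le_pi_norm x n.castSucc]) hA.α_nonneg
    have := mul_le_mul_of_nonneg_left (h1.trans (mul_le_mul_of_nonneg_left h2 zero_le_two))
      hA.Ca_nonneg
    linarith
  refine (abs_stepForm_le hf hg hinv).trans_eq ?_
  rw [growthWeight, two_mul (max κ 1), Real.rpow_add hpos, Real.rpow_add hpos]
  ring

variable (Ca CK N₀) in
/-- A constant that dominates those of the growth bounds of the three parts of the energy. -/
noncomputable def formBound : ℝ := 2 * N₀ * Ca * (2 + √(2 * CK)) ^ 2

theorem ModelAssumption.formBound_nonneg (hA : ModelAssumption (H := H) 𝓜 Cσ Ca CK B s α κ) :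
    0 ≤ formBound N₀ Ca CK := by
  have := hA.Ca_nonneg
  unfold formBound
  positivity

theorem ModelAssumption.abs_stepForm_drift_drift_le
    (hA : ModelAssumption (H := H) 𝓜 Cσ Ca CK B s α κ) (b b' : H) (x : Path d N₀) :
    |𝓜.stepForm x (drift b x) (drift b' x)|
      ≤ formBound N₀ Ca CK * ‖b‖ * ‖b'‖ * growthWeight κ α x := by
  refine (hA.abs_stepForm_le_growthWeight (hA.norm_drift_le b x) (hA.norm_drift_le b' x)).trans ?_
  have := hA.Ca_nonneg
  refine mul_le_mul_of_nonneg_right ?_ (growthWeight_nonneg _ _ _)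
  have h1 : √(2 * CK) * √(2 * CK) ≤ (2 + √(2 * CK)) ^ 2 := by
    nlinarith [Real.sqrt_nonneg (2 * CK)]
  unfold formBound
  calc _ = 2 * N₀ * Ca * (√(2 * CK) * √(2 * CK)) * ‖b‖ * ‖b'‖ := by ring
    _ ≤ _ := by gcongr

theorem ModelAssumption.abs_stepForm_incr_drift_le
    (hA : ModelAssumption (H := H) 𝓜 Cσ Ca CK B s α κ) (b : H) (x : Path d N₀) :
    |𝓜.stepForm x (incr x) (drift b x)|
      ≤ formBound N₀ Ca CK * ‖b‖ * growthWeight κ α x := by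
  refine (hA.abs_stepForm_le_growthWeight (norm_incr_le κ x) (hA.norm_drift_le b x)).trans ?_
  have := hA.Ca_nonneg
  refine mul_le_mul_of_nonneg_right ?_ (growthWeight_nonneg _ _ _)
  have h1 : 2 * √(2 * CK) ≤ (2 + √(2 * CK)) ^ 2 := by
    nlinarith [Real.sqrt_nonneg (2 * CK)]
  unfold formBound
  calc _ = 2 * N₀ * Ca * (2 * √(2 * CK)) * ‖b‖ := by ring
    _ ≤ _ := by gcongr

theorem ModelAssumption.abs_stepForm_incr_incr_le
    (hA : ModelAssumption (H := H) 𝓜 Cσ Ca CK B s α κ) (x : Path d N₀) :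
    |𝓜.stepForm x (incr x) (incr x)| ≤ formBound N₀ Ca CK * growthWeight κ α x := by
  refine (hA.abs_stepForm_le_growthWeight (norm_incr_le κ x) (norm_incr_le κ x)).trans ?_
  have := hA.Ca_nonneg
  refine mul_le_mul_of_nonneg_right ?_ (growthWeight_nonneg _ _ _)
  have h1 : (2 : ℝ) * 2 ≤ (2 + √(2 * CK)) ^ 2 := by
    nlinarith [Real.sqrt_nonneg (2 * CK)]
  unfold formBound
  calc _ = 2 * N₀ * Ca * (2 * 2) := by ring
    _ ≤ _ := by gcongr

section Integrals

variable {μ : Measure (Path d N₀)}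

theorem ModelAssumption.measurable_coe (hA : ModelAssumption (H := H) 𝓜 Cσ Ca CK B s α κ) (b : H) :
    Measurable (b : Euc d → Euc d) := (hA.continuous_coe b).measurable

theorem ModelAssumption.measurable_drift_drift
    (hA : ModelAssumption (H := H) 𝓜 Cσ Ca CK B s α κ) (b b' : H) :
    Measurable fun x => 𝓜.stepForm x (drift b x) (drift b' x) :=
  measurable_stepForm (measurable_drift (hA.measurable_coe b))
    (measurable_drift (hA.measurable_coe b'))

theorem ModelAssumption.measurable_incr_drift
    (hA : ModelAssumption (H := H) 𝓜 Cσ Ca CK B s α κ) (b : H) :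
    Measurable fun x => 𝓜.stepForm x (incr x) (drift b x) :=
  measurable_stepForm measurable_incr (measurable_drift (hA.measurable_coe b))

theorem integrable_of_abs_le_mul {Ω : Type*} [MeasurableSpace Ω] {μ : Measure Ω} {f w : Ω → ℝ}
    (hf : Measurable f) (hw : Integrable w μ) {c : ℝ} (h : ∀ x, |f x| ≤ c * w x) :
    Integrable f μ :=
  (hw.const_mul c).mono' hf.aestronglyMeasurable (Eventually.of_forall h)

theorem ModelAssumption.integrable_drift_drift
    (hA : ModelAssumption (H := H) 𝓜 Cσ Ca CK B s α κ) (hμ : Integrable (growthWeight κ α) μ)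
    (b b' : H) : Integrable (fun x => 𝓜.stepForm x (drift b x) (drift b' x)) μ :=
  integrable_of_abs_le_mul (hA.measurable_drift_drift b b') hμ
    (hA.abs_stepForm_drift_drift_le b b')

theorem ModelAssumption.integrable_incr_drift
    (hA : ModelAssumption (H := H) 𝓜 Cσ Ca CK B s α κ) (hμ : Integrable (growthWeight κ α) μ)
    (b : H) : Integrable (fun x => 𝓜.stepForm x (incr x) (drift b x)) μ :=
  integrable_of_abs_le_mul (hA.measurable_incr_drift b) hμ (hA.abs_stepForm_incr_drift_le b)

theorem ModelAssumption.integrable_energy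
    (hA : ModelAssumption (H := H) 𝓜 Cσ Ca CK B s α κ) (hμ : Integrable (growthWeight κ α) μ)
    (b : H) : Integrable (fun x => 𝓜.energy b x) μ := by
  have h1 : Integrable (fun x => 𝓜.stepForm x (incr x) (incr x)) μ :=
    integrable_of_abs_le_mul (measurable_stepForm measurable_incr measurable_incr) hμ
      hA.abs_stepForm_incr_incr_le
  simp_rw [energy_eq]
  exact ((h1.const_mul _).sub (hA.integrable_incr_drift hμ b)).add
    ((hA.integrable_drift_drift hμ b b).const_mul _)

variable (𝓜) in
/-- The Euler-Lagrange equation of the risk: `v` is a critical point of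
`b ↦ ∫ energy b dμ + lam * ‖b‖ ^ 2`. -/
def IsCritical (lam : ℝ) (μ : Measure (Path d N₀)) (v : H) : Prop :=
  ∀ w : H, 𝓜.Δ * ∫ x, 𝓜.stepForm x (drift v x) (drift w x) ∂μ + 2 * lam * inner ℝ v w
    = ∫ x, 𝓜.stepForm x (incr x) (drift w x) ∂μ

/-- Strong convexity of the risk. -/
theorem ModelAssumption.integral_energy_add_le
    (hA : ModelAssumption (H := H) 𝓜 Cσ Ca CK B s α κ) (hμ : Integrable (growthWeight κ α) μ)
    {lam : ℝ} {v : H} (hv : IsCritical 𝓜 lam μ v) (b : H) :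
    ∫ x, 𝓜.energy v x ∂μ + lam * ‖v‖ ^ 2 + lam * ‖b - v‖ ^ 2
      ≤ ∫ x, 𝓜.energy b x ∂μ + lam * ‖b‖ ^ 2 := by
  set h := b - v with hh
  have hb : b = v + h := by rw [hh]; abel
  have e1 : ∫ x, 𝓜.energy b x ∂μ = ∫ x, 𝓜.energy v x ∂μ
      - ∫ x, 𝓜.stepForm x (incr x) (drift h x) ∂μ
      + 𝓜.Δ * ∫ x, 𝓜.stepForm x (drift v x) (drift h x) ∂μ
      + 𝓜.Δ / 2 * ∫ x, 𝓜.stepForm x (drift h x) (drift h x) ∂μ := by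
    have i1 : Integrable (fun x => 𝓜.energy v x - 𝓜.stepForm x (incr x) (drift h x)) μ :=
      (hA.integrable_energy hμ v).sub (hA.integrable_incr_drift hμ h)
    have i2 : Integrable (fun x => 𝓜.energy v x - 𝓜.stepForm x (incr x) (drift h x)
        + 𝓜.Δ * 𝓜.stepForm x (drift v x) (drift h x)) μ :=
      i1.add ((hA.integrable_drift_drift hμ v h).const_mul _)
    rw [← integral_const_mul, ← integral_const_mul,
      ← integral_sub (hA.integrable_energy hμ v) (hA.integrable_incr_drift hμ h),
      ← integral_add i1 ((hA.integrable_drift_drift hμ v h).const_mul _),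
      ← integral_add i2 ((hA.integrable_drift_drift hμ h h).const_mul _)]
    refine integral_congr_ae (Eventually.of_forall fun x => ?_)
    simp only [hb, RKHS.coe_add]
    exact energy_add _ _ _
  have e2 : ‖b‖ ^ 2 = ‖v‖ ^ 2 + 2 * inner ℝ v h + ‖h‖ ^ 2 := by rw [hb, norm_add_sq_real]
  have e3 := hv h
  have e4 : 0 ≤ ∫ x, 𝓜.stepForm x (drift h x) (drift h x) ∂μ :=
    integral_nonneg fun x => stepForm_self_nonneg _ _
  have e5 : 0 ≤ 𝓜.Δ / 2 * ∫ x, 𝓜.stepForm x (drift h x) (drift h x) ∂μ :=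
    mul_nonneg (half_pos 𝓜.Δ_pos).le e4
  rw [e1, e2]
  linarith

/-- Existence of the critical point, by the Lax-Milgram theorem. -/
theorem ModelAssumption.exists_isCritical
    (hA : ModelAssumption (H := H) 𝓜 Cσ Ca CK B s α κ) (hμ : Integrable (growthWeight κ α) μ)
    {lam : ℝ} (hlam : 0 < lam) : ∃ v : H, IsCritical 𝓜 lam μ v := by
  have hI := hA.integrable_drift_drift hμ
  have hI' := hA.integrable_incr_drift hμ
  set W := ∫ x, growthWeight κ α x ∂μ with hW
  have hW0 : 0 ≤ W := integral_nonneg fun x => growthWeight_nonneg _ _ _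
  have hfb := hA.formBound_nonneg
  have hΔ := 𝓜.Δ_pos
  have hbd : ∀ v w : H, |∫ x, 𝓜.stepForm x (drift v x) (drift w x) ∂μ|
      ≤ formBound N₀ Ca CK * W * ‖v‖ * ‖w‖ := fun v w => by
    rw [← Real.norm_eq_abs]
    refine (norm_integral_le_of_norm_le (hμ.const_mul _)
      (Eventually.of_forall fun x => hA.abs_stepForm_drift_drift_le v w x)).trans_eq ?_
    rw [integral_const_mul]
    ring
  set Bil : H →ₗ[ℝ] H →ₗ[ℝ] ℝ := LinearMap.mk₂ ℝ
    (fun v w => 𝓜.Δ * ∫ x, 𝓜.stepForm x (drift v x) (drift w x) ∂μ + 2 * lam * inner ℝ v w)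
    (fun v v' w => by
      simp only [drift_add, stepForm_add_left, inner_add_left]
      rw [integral_add (hI v w) (hI v' w)]
      ring)
    (fun c v w => by
      simp only [drift_smul, stepForm_smul_left, real_inner_smul_left, smul_eq_mul]
      rw [integral_const_mul]
      ring)
    (fun v w w' => by
      simp only [drift_add, stepForm_add_right, inner_add_right]
      rw [integral_add (hI v w) (hI v w')]
      ring)
    (fun c v w => by
      simp only [drift_smul, stepForm_smul_right, real_inner_smul_right, smul_eq_mul]
      rw [integral_const_mul]
      ring) with hBil
  set Lin : H →ₗ[ℝ] ℝ :=
    { toFun := fun w => ∫ x, 𝓜.stepForm x (incr x) (drift w x) ∂μ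
      map_add' := fun w w' => by
        simp only [drift_add, stepForm_add_right]
        exact integral_add (hI' w) (hI' w')
      map_smul' := fun c w => by
        simp only [drift_smul, stepForm_smul_right, RingHom.id_apply, smul_eq_mul]
        exact integral_const_mul _ _ } with hLin
  set LinC : H →L[ℝ] ℝ := Lin.mkContinuous (formBound N₀ Ca CK * W) (fun w => by
    refine (norm_integral_le_of_norm_le (hμ.const_mul _)
      (Eventually.of_forall fun x => hA.abs_stepForm_incr_drift_le w x)).trans_eq ?_
    rw [integral_const_mul]
    ring)
  set BilC : H →L[ℝ] H →L[ℝ] ℝ := Bil.mkContinuous₂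
      (𝓜.Δ * (formBound N₀ Ca CK * W) + 2 * lam) (fun v w => by
    have h1 := hbd v w
    have h2 := abs_real_inner_le_norm v w
    simp only [hBil, LinearMap.mk₂_apply, Real.norm_eq_abs]
    refine (abs_add_le _ _).trans ?_
    rw [abs_mul, abs_mul, abs_of_pos hΔ, abs_of_pos (by positivity : 0 < 2 * lam)]
    have h3 := mul_le_mul_of_nonneg_left h1 hΔ.le
    have h4 := mul_le_mul_of_nonneg_left h2 (by positivity : 0 ≤ 2 * lam)
    linarith)
  have hcoer : IsCoercive BilC := ⟨2 * lam, by positivity, fun v => by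
    have h1 : 0 ≤ ∫ x, 𝓜.stepForm x (drift v x) (drift v x) ∂μ :=
      integral_nonneg fun x => stepForm_self_nonneg _ _
    have h2 : BilC v v = 𝓜.Δ * ∫ x, 𝓜.stepForm x (drift v x) (drift v x) ∂μ
      + 2 * lam * inner ℝ v v := rfl
    rw [h2, real_inner_self_eq_norm_mul_norm]
    have := mul_nonneg hΔ.le h1
    linarith⟩
  refine ⟨hcoer.continuousLinearEquivOfBilin.symm ((InnerProductSpace.toDual ℝ H).symm LinC),
    fun w => ?_⟩
  have h := hcoer.continuousLinearEquivOfBilin_apply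
    (hcoer.continuousLinearEquivOfBilin.symm ((InnerProductSpace.toDual ℝ H).symm LinC)) w
  rw [ContinuousLinearEquiv.apply_symm_apply, InnerProductSpace.toDual_symm_apply] at h
  exact h.symm

/-- The critical point depends continuously on the measure, with respect to total variation
weighted by `growthWeight`. -/
theorem ModelAssumption.tendsto_of_isCritical
    (hA : ModelAssumption (H := H) 𝓜 Cσ Ca CK B s α κ) {lam : ℝ} (hlam : 0 < lam)
    {μs : ℕ → Measure (Path d N₀)} (hμ : Integrable (growthWeight κ α) μ)
    (hμs : ∀ᶠ k in atTop, Integrable (growthWeight κ α) (μs k))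
    (hconv : WeightedTVTendsto (growthWeight κ α) μs μ) {v : H} {vs : ℕ → H}
    (hv : IsCritical 𝓜 lam μ v) (hvs : ∀ᶠ k in atTop, IsCritical 𝓜 lam (μs k) (vs k)) :
    Tendsto vs atTop (𝓝 v) := by
  have hfb := hA.formBound_nonneg
  have hΔ := 𝓜.Δ_pos
  set F := formBound N₀ Ca CK with hF
  set D := (F + 1) * (1 + 𝓜.Δ * ‖v‖) with hD
  have hD0 : 0 < D := by positivity
  rw [Metric.tendsto_nhds]
  intro ε hε
  filter_upwards [hconv (lam * ε / D) (by positivity), hμs, hvs] with k hk hμk hvk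
  set w := vs k - v with hw
  -- a test function bounded by a multiple of the weight
  have htest : ∀ (f : Path d N₀ → ℝ) (c : ℝ), 0 < c → Measurable f →
      (∀ x, |f x| ≤ c * growthWeight κ α x) →
      |∫ x, f x ∂μs k - ∫ x, f x ∂μ| ≤ c * (lam * ε / D) := fun f c hc hf hfc => by
    have h1 := hk (fun x => f x / c) (hf.div_const c) (fun x => by
      rw [abs_div, abs_of_pos hc, div_le_iff₀ hc, mul_comm]
      exact hfc x)
    rw [integral_div, integral_div, ← sub_div, abs_div, abs_of_pos hc, div_le_iff₀ hc] at h1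
    linarith
  rw [dist_eq_norm, ← hw]
  rcases (norm_nonneg w).eq_or_lt with h0 | h0
  · rwa [← h0]
  set f : Path d N₀ → ℝ := fun x => 𝓜.stepForm x (incr x) (drift w x)
    - 𝓜.Δ * 𝓜.stepForm x (drift v x) (drift w x) with hf
  have hfm : Measurable f :=
    (hA.measurable_incr_drift w).sub ((hA.measurable_drift_drift v w).const_mul _)
  have hfi : ∀ ν : Measure (Path d N₀), Integrable (growthWeight κ α) ν →
      ∫ x, f x ∂ν = ∫ x, 𝓜.stepForm x (incr x) (drift w x) ∂ν
        - 𝓜.Δ * ∫ x, 𝓜.stepForm x (drift v x) (drift w x) ∂ν := fun ν hν => by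
    rw [← integral_const_mul, ← integral_sub (hA.integrable_incr_drift hν w)
      ((hA.integrable_drift_drift hν v w).const_mul _)]
  have h1 := htest f (D * ‖w‖) (by positivity) hfm (fun x => by
    have e1 := hA.abs_stepForm_incr_drift_le w x
    have e2 := mul_le_mul_of_nonneg_left (hA.abs_stepForm_drift_drift_le v w x) hΔ.le
    have e3 := abs_sub (𝓜.stepForm x (incr x) (drift w x))
      (𝓜.Δ * 𝓜.stepForm x (drift v x) (drift w x))
    rw [abs_mul, abs_of_pos hΔ] at e3
    have e4 := growthWeight_nonneg κ α x
    have e5 : 0 ≤ (1 + 𝓜.Δ * ‖v‖) * ‖w‖ * growthWeight κ α x := by positivity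
    calc |f x| ≤ F * ((1 + 𝓜.Δ * ‖v‖) * ‖w‖ * growthWeight κ α x) := by
          simp only [hf]
          linarith
      _ ≤ (F + 1) * ((1 + 𝓜.Δ * ‖v‖) * ‖w‖ * growthWeight κ α x) := by
          gcongr
          linarith
      _ = _ := by rw [hD]; ring)
  rw [hfi _ hμk, hfi _ hμ] at h1
  have h2 := hv w
  have h3 := hvk w
  have h4 : ∫ x, 𝓜.stepForm x (drift (vs k) x) (drift w x) ∂μs k
      = ∫ x, 𝓜.stepForm x (drift v x) (drift w x) ∂μs k
        + ∫ x, 𝓜.stepForm x (drift w x) (drift w x) ∂μs k := by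
    rw [← integral_add (hA.integrable_drift_drift hμk v w) (hA.integrable_drift_drift hμk w w)]
    refine integral_congr_ae (Eventually.of_forall fun x => ?_)
    simp only [← stepForm_add_left, ← drift_add]
    rw [hw, add_sub_cancel]
  have h5 : inner ℝ (vs k) w = inner ℝ v w + ‖w‖ ^ 2 := by
    rw [← real_inner_self_eq_norm_sq, ← inner_add_left, hw, add_sub_cancel]
  have h6 : 0 ≤ 𝓜.Δ * ∫ x, 𝓜.stepForm x (drift w x) (drift w x) ∂μs k :=
    mul_nonneg hΔ.le (integral_nonneg fun x => stepForm_self_nonneg _ _)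
  -- subtraction of the two Euler-Lagrange equations, tested with `w`
  have h7 : 2 * lam * ‖w‖ ^ 2 ≤ D * ‖w‖ * (lam * ε / D) := by
    refine le_trans ?_ ((le_abs_self _).trans h1)
    rw [h4, h5] at h3
    linarith
  have h8 : D * ‖w‖ * (lam * ε / D) = lam * ε * ‖w‖ := by field_simp
  rw [h8] at h7
  have h9 : 2 * ‖w‖ ≤ ε := by
    have : (lam * ‖w‖) * (2 * ‖w‖) ≤ (lam * ‖w‖) * ε := by nlinarith
    exact le_of_mul_le_mul_left this (by positivity)
  linarith

end Integrals

end RKHS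

end EMDrift

namespace EMDrift

open ObservedDiffusion InformationTheory

/-! ### The filtering distribution -/

section RKHS

variable {d d₀ N₀ M₀ : ℕ} {𝓜 : ObservedDiffusion d d₀ N₀ M₀}
variable {H : Type*} [NormedAddCommGroup H] [InnerProductSpace ℝ H] [CompleteSpace H]
  [RKHS ℝ H (Euc d) (Euc d)]
variable {Cσ Ca CK B s α κ : ℝ}

theorem ModelAssumption.prod_ρ_le (hA : ModelAssumption (H := H) 𝓜 Cσ Ca CK B s α κ)
    (x : Path d N₀) : ∏ m : Fin M₀, 𝓜.ρ (𝓜.y m) (x (𝓜.obsIdx m)) ≤ B ^ M₀ := by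
  refine (Finset.prod_le_prod (fun m _ => 𝓜.ρ_nonneg _ _) fun m _ =>
    hA.ρ_bound (𝓜.y m) (x (𝓜.obsIdx m))).trans_eq ?_
  simp

theorem prod_ρ_nonneg (𝓜 : ObservedDiffusion d d₀ N₀ M₀) (x : Path d N₀) :
    0 ≤ ∏ m : Fin M₀, 𝓜.ρ (𝓜.y m) (x (𝓜.obsIdx m)) :=
  Finset.prod_nonneg fun _ _ => 𝓜.ρ_nonneg _ _

theorem jointDensity_nonneg (𝓜 : ObservedDiffusion d d₀ N₀ M₀) (b : Euc d → Euc d)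
    (x : Path d N₀) : 0 ≤ 𝓜.jointDensity b x :=
  mul_nonneg (𝓜.pathDensity_nonneg b x) (prod_ρ_nonneg 𝓜 x)

theorem measurable_jointDensity (𝓜 : ObservedDiffusion d d₀ N₀ M₀) {b : Euc d → Euc d}
    (hb : Measurable b) : Measurable (𝓜.jointDensity b) := by
  refine (𝓜.measurable_pathDensity hb).mul (Finset.measurable_fun_prod _ fun m _ => ?_)
  exact 𝓜.ρ_measurable.comp (measurable_const.prodMk (measurable_pi_apply (𝓜.obsIdx m)))

theorem ModelAssumption.jointDensity_le (hA : ModelAssumption (H := H) 𝓜 Cσ Ca CK B s α κ)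
    (b : Euc d → Euc d) (x : Path d N₀) :
    𝓜.jointDensity b x ≤ B ^ M₀ * 𝓜.pathDensity b x := by
  rw [jointDensity, mul_comm]
  exact mul_le_mul_of_nonneg_right (hA.prod_ρ_le x) (𝓜.pathDensity_nonneg b x)

theorem ModelAssumption.integrable_jointDensity
    (hA : ModelAssumption (H := H) 𝓜 Cσ Ca CK B s α κ) (b : H) :
    Integrable (fun x : Path d N₀ => 𝓜.jointDensity b x) := by
  refine ((integrable_pathDensity hA.a_isUnit (hA.measurable_coe b)).const_mul (B ^ M₀)).mono'
    (measurable_jointDensity 𝓜 (hA.measurable_coe b)).aestronglyMeasurable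
    (Eventually.of_forall fun x => ?_)
  rw [Real.norm_of_nonneg (jointDensity_nonneg _ _ _)]
  exact hA.jointDensity_le b x

theorem ModelAssumption.obsDensity_le (hA : ModelAssumption (H := H) 𝓜 Cσ Ca CK B s α κ) (b : H) :
    𝓜.obsDensity b ≤ B ^ M₀ := by
  have h := integral_mono (hA.integrable_jointDensity b)
    ((integrable_pathDensity hA.a_isUnit (hA.measurable_coe b)).const_mul (B ^ M₀))
    (hA.jointDensity_le b)
  rwa [integral_const_mul, integral_pathDensity hA.a_isUnit (hA.measurable_coe b), mul_one] at h

theorem measurable_filterDensity (𝓜 : ObservedDiffusion d d₀ N₀ M₀) {b : Euc d → Euc d}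
    (hb : Measurable b) : Measurable fun x => 𝓜.jointDensity b x / 𝓜.obsDensity b :=
  (measurable_jointDensity 𝓜 hb).div_const _

theorem ModelAssumption.isProbabilityMeasure_filter
    (hA : ModelAssumption (H := H) 𝓜 Cσ Ca CK B s α κ) {b : H} (hb : 0 < 𝓜.obsDensity b) :
    IsProbabilityMeasure (𝓜.filter b) := by
  refine ⟨?_⟩
  rw [ObservedDiffusion.filter, withDensity_apply _ MeasurableSet.univ, Measure.restrict_univ,
    ← ofReal_integral_eq_lintegral_ofReal ((hA.integrable_jointDensity b).div_const _)
      (Eventually.of_forall fun x => div_nonneg (jointDensity_nonneg _ _ _) hb.le),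
    integral_div, ← ObservedDiffusion.obsDensity, div_self hb.ne', ENNReal.ofReal_one]

/-- Moments of the filtering distributions of bounded drifts. -/
theorem ModelAssumption.exists_filter_moment_bound
    (hA : ModelAssumption (H := H) 𝓜 Cσ Ca CK B s α κ)
    (hf₀ : ∀ q : ℝ, 0 < q → ∫⁻ x, ENNReal.ofReal (‖x‖ ^ q * 𝓜.f₀ x) < ∞) (r : ℝ) (q : ℕ) :
    ∃ M : ℝ, ∀ b : H, ‖b‖ ≤ r → 0 < 𝓜.obsDensity b →
      ∫⁻ x, ENNReal.ofReal ((1 + ‖x‖) ^ q) ∂𝓜.filter b ≤ ENNReal.ofReal (M / 𝓜.obsDensity b) := by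
  obtain ⟨M, hM⟩ := hA.exists_moment_bound hf₀ r q
  refine ⟨B ^ M₀ * M, fun b hb hpos => ?_⟩
  have hB : 0 ≤ B ^ M₀ := pow_nonneg hA.B_nonneg _
  rw [ObservedDiffusion.filter, lintegral_withDensity_eq_lintegral_mul _
    (measurable_filterDensity 𝓜 (hA.measurable_coe b)).ennreal_ofReal (by fun_prop)]
  have hpt : ∀ x : Path d N₀, ENNReal.ofReal (𝓜.jointDensity b x / 𝓜.obsDensity b) *
      ENNReal.ofReal ((1 + ‖x‖) ^ q) ≤ ENNReal.ofReal (B ^ M₀ / 𝓜.obsDensity b) *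
        ENNReal.ofReal ((1 + ‖x‖) ^ q * 𝓜.pathDensity b x) := fun x => by
    rw [← ENNReal.ofReal_mul (div_nonneg (jointDensity_nonneg _ _ _) hpos.le),
      ← ENNReal.ofReal_mul (by positivity)]
    refine ENNReal.ofReal_le_ofReal ?_
    have h1 := hA.jointDensity_le b x
    calc 𝓜.jointDensity b x / 𝓜.obsDensity b * (1 + ‖x‖) ^ q
        ≤ B ^ M₀ * 𝓜.pathDensity b x / 𝓜.obsDensity b * (1 + ‖x‖) ^ q := by gcongr
      _ = _ := by ring
  refine (lintegral_mono hpt).trans ?_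
  rw [lintegral_const_mul' _ _ ENNReal.ofReal_ne_top]
  refine (mul_le_mul_right (hM b hb) _).trans_eq ?_
  rw [← ENNReal.ofReal_mul (by positivity)]
  congr 1
  ring

theorem integrable_growthWeight_of_lintegral_lt_top {μ : Measure (Path d N₀)} {κ α p : ℝ}
    (hp : 2 * max κ 1 + α ≤ p) (h : ∫⁻ x, ENNReal.ofReal ((1 + ‖x‖) ^ p) ∂μ < ∞) :
    Integrable (growthWeight κ α) μ := by
  refine (lintegral_ofReal_ne_top_iff_integrable
    (measurable_growthWeight κ α).aestronglyMeasurable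
    (Eventually.of_forall (growthWeight_nonneg κ α))).1 (ne_top_of_le_ne_top h.ne ?_)
  refine lintegral_mono fun x => ENNReal.ofReal_le_ofReal ?_
  exact Real.rpow_le_rpow_of_exponent_le (by linarith [norm_nonneg x]) hp

theorem ModelAssumption.integrable_growthWeight_filter
    (hA : ModelAssumption (H := H) 𝓜 Cσ Ca CK B s α κ)
    (hf₀ : ∀ q : ℝ, 0 < q → ∫⁻ x, ENNReal.ofReal (‖x‖ ^ q * 𝓜.f₀ x) < ∞) {b : H}
    (hb : 0 < 𝓜.obsDensity b) : Integrable (growthWeight κ α) (𝓜.filter b) := by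
  obtain ⟨q, hq⟩ := exists_nat_ge (2 * max κ 1 + α)
  obtain ⟨M, hM⟩ := hA.exists_filter_moment_bound hf₀ ‖b‖ q
  refine integrable_growthWeight_of_lintegral_lt_top hq ?_
  simp_rw [Real.rpow_natCast]
  exact (hM b le_rfl hb).trans_lt ENNReal.ofReal_lt_top

/-- Total variation convergence with bounded moments of an order larger than
`2 max(κ, 1) + α` implies convergence in total variation weighted by `growthWeight`. -/
theorem weightedTVTendsto_growthWeight {μs : ℕ → Measure (Path d N₀)} {μ : Measure (Path d N₀)}
    [∀ k, IsProbabilityMeasure (μs k)] [IsProbabilityMeasure μ]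
    (h : WeightedTVTendsto (fun _ => 1) μs μ) {κ α p C : ℝ} (hp : 2 * max κ 1 + α < p)
    (hα : 0 ≤ α)
    (hC : ∀ᶠ k in atTop, ∫⁻ x, ENNReal.ofReal ((1 + ‖x‖) ^ p) ∂μs k ≤ ENNReal.ofReal C) :
    WeightedTVTendsto (growthWeight κ α) μs μ := by
  refine h.of_lintegral_le (g := fun x => (1 + ‖x‖) ^ p) (by fun_prop)
    (fun x => by positivity) hC (measurable_growthWeight κ α) fun η hη => ?_
  set m := 2 * max κ 1 + α with hm
  have hm0 : 0 < m := by
    have := le_max_right κ 1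
    linarith
  have hpm : 0 < p - m := by linarith
  set T : ℝ := (1 / η) ^ (1 / (p - m)) with hT
  have hT0 : 0 < T := by positivity
  refine ⟨T ^ m, by positivity, fun x hx => ?_⟩
  have hS : 0 < 1 + ‖x‖ := by positivity
  have h1 : T < 1 + ‖x‖ := (Real.rpow_lt_rpow_iff hT0.le hS.le hm0).1 hx
  have h2 : 1 / η ≤ (1 + ‖x‖) ^ (p - m) := by
    have h3 := Real.rpow_le_rpow hT0.le h1.le hpm.le
    rwa [hT, ← Real.rpow_mul (by positivity), one_div_mul_cancel hpm.ne', Real.rpow_one] at h3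
  have h4 : (1 + ‖x‖) ^ p = (1 + ‖x‖) ^ m * (1 + ‖x‖) ^ (p - m) := by
    rw [← Real.rpow_add hS]
    ring_nf
  rw [h4]
  have h5 : 1 ≤ η * (1 + ‖x‖) ^ (p - m) := by
    rwa [div_le_iff₀ hη, mul_comm] at h2
  have h6 : 0 ≤ (1 + ‖x‖) ^ m := by positivity
  change (1 + ‖x‖) ^ m ≤ _
  nlinarith

/-- The EM inequality, a consequence of Jensen's inequality: a drift that decreases the risk under
the filtering distribution of `b` decreases the loss at least as much. -/
theorem ModelAssumption.loss_sub_loss_le (hA : ModelAssumption (H := H) 𝓜 Cσ Ca CK B s α κ)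
    (hf₀ : ∀ q : ℝ, 0 < q → ∫⁻ x, ENNReal.ofReal (‖x‖ ^ q * 𝓜.f₀ x) < ∞) (lam : ℝ) {b b' : H}
    (hb : 0 < 𝓜.obsDensity b) (hb' : 0 < 𝓜.obsDensity b') :
    loss 𝓜 lam b' - loss 𝓜 lam b ≤
      (∫ x, 𝓜.energy b' x ∂𝓜.filter b + lam * ‖b'‖ ^ 2)
        - (∫ x, 𝓜.energy b x ∂𝓜.filter b + lam * ‖b‖ ^ 2) := by
  have := hA.isProbabilityMeasure_filter hb
  have hG := hA.integrable_growthWeight_filter hf₀ hb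
  set D : Path d N₀ → ℝ := fun x => 𝓜.energy b x - 𝓜.energy b' x with hD
  have hDi : Integrable D (𝓜.filter b) :=
    (hA.integrable_energy hG b).sub (hA.integrable_energy hG b')
  have hm := measurable_filterDensity 𝓜 (hA.measurable_coe b)
  have hnn : ∀ x, 0 ≤ 𝓜.jointDensity b x / 𝓜.obsDensity b := fun x =>
    div_nonneg (jointDensity_nonneg _ _ _) hb.le
  have hratio : ∀ x, 𝓜.jointDensity b x / 𝓜.obsDensity b * Real.exp (D x)
      = 𝓜.jointDensity b' x / 𝓜.obsDensity b := fun x => by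
    rw [jointDensity, jointDensity, pathDensity_eq_mul_exp hA.a_isUnit b b']
    ring
  have hint : ∫ x, Real.exp (D x) ∂𝓜.filter b = 𝓜.obsDensity b' / 𝓜.obsDensity b := by
    rw [ObservedDiffusion.filter, integral_withDensity_ofReal hm hnn]
    simp_rw [hratio]
    rw [integral_div]
    rfl
  have hexp : Integrable (fun x => Real.exp (D x)) (𝓜.filter b) := by
    by_contra hni
    rw [integral_undef hni] at hint
    exact (div_pos hb' hb).ne hint
  have hJ := convexOn_exp.map_integral_le (μ := 𝓜.filter b) (f := D)
    Real.continuous_exp.continuousOn isClosed_univ (Eventually.of_forall fun _ => mem_univ _)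
    hDi hexp
  rw [hint] at hJ
  have hlog := Real.log_le_log (Real.exp_pos _) hJ
  rw [Real.log_exp, Real.log_div hb'.ne' hb.ne',
    integral_sub (hA.integrable_energy hG b) (hA.integrable_energy hG b')] at hlog
  unfold loss
  linarith

/-! ### Continuity of the filtering distribution in the drift -/

theorem continuous_stepForm_self (x : Path d N₀) :
    Continuous fun f : Fin N₀ → Euc d => 𝓜.stepForm x f f := by
  unfold stepForm dotProduct Matrix.mulVec dotProduct
  fun_prop

theorem tendsto_pathDensity (ha : ∀ u, IsUnit (𝓜.a u)) {us : ℕ → Euc d → Euc d}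
    {b : Euc d → Euc d} (h : ∀ x, Tendsto (fun k => us k x) atTop (𝓝 (b x))) (x : Path d N₀) :
    Tendsto (fun k => 𝓜.pathDensity (us k) x) atTop (𝓝 (𝓜.pathDensity b x)) := by
  have h1 : Tendsto (fun k => drift (us k) x) atTop (𝓝 (drift b x)) :=
    tendsto_pi_nhds.2 fun n => h _
  have h2 : Tendsto (fun k => 𝓜.energy (us k) x) atTop (𝓝 (𝓜.energy b x)) := by
    have h3 : Tendsto (fun k => incr x - 𝓜.Δ • drift (us k) x) atTop
        (𝓝 (incr x - 𝓜.Δ • drift b x)) := tendsto_const_nhds.sub (h1.const_smul 𝓜.Δ)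
    exact (((continuous_stepForm_self x).tendsto _).comp h3).const_mul _
  simp_rw [pathDensity_eq ha]
  exact ((Real.continuous_exp.tendsto _).comp h2.neg).const_mul _

theorem ModelAssumption.tendsto_obsDensity (hA : ModelAssumption (H := H) 𝓜 Cσ Ca CK B s α κ)
    {us : ℕ → H} {b : H} (h : ∀ x, Tendsto (fun k => us k x) atTop (𝓝 (b x))) :
    Tendsto (fun k => 𝓜.obsDensity (us k)) atTop (𝓝 (𝓜.obsDensity b)) := by
  have hi : ∀ c : H, Integrable (fun x : Path d N₀ => 𝓜.pathDensity c x) := fun c =>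
    integrable_pathDensity hA.a_isUnit (hA.measurable_coe c)
  have hL1 := tendsto_integral_abs_sub_of_tendsto (fun k => hi (us k)) (hi b)
    (fun k => 𝓜.pathDensity_nonneg _) (𝓜.pathDensity_nonneg _)
    (tendsto_pathDensity hA.a_isUnit h) (by
      simp_rw [integral_pathDensity hA.a_isUnit (hA.measurable_coe _)]
      exact tendsto_const_nhds)
  have h1 := hL1.const_mul (B ^ M₀)
  rw [mul_zero] at h1
  refine tendsto_iff_norm_sub_tendsto_zero.2 (squeeze_zero (fun _ => norm_nonneg _)
    (fun k => ?_) h1)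
  rw [obsDensity, obsDensity,
    ← integral_sub (hA.integrable_jointDensity (us k)) (hA.integrable_jointDensity b),
    ← integral_const_mul]
  refine norm_integral_le_of_norm_le (((hi (us k)).sub (hi b)).abs.const_mul _)
    (Eventually.of_forall fun x => ?_)
  rw [jointDensity, jointDensity, ← sub_mul, norm_mul, mul_comm, Real.norm_eq_abs,
    Real.norm_eq_abs, abs_of_nonneg (prod_ρ_nonneg 𝓜 x)]
  exact mul_le_mul_of_nonneg_right (hA.prod_ρ_le x) (abs_nonneg _)

/-- The filtering distribution depends continuously on the drift, from pointwise convergence of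
norm bounded drifts to weighted total variation convergence. -/
theorem ModelAssumption.weightedTVTendsto_filter
    (hA : ModelAssumption (H := H) 𝓜 Cσ Ca CK B s α κ)
    (hf₀ : ∀ q : ℝ, 0 < q → ∫⁻ x, ENNReal.ofReal (‖x‖ ^ q * 𝓜.f₀ x) < ∞)
    (hy : ∀ b : H, 0 < 𝓜.obsDensity b) {us : ℕ → H} {b : H} {r : ℝ} (hr : ∀ k, ‖us k‖ ≤ r)
    (h : ∀ x, Tendsto (fun k => us k x) atTop (𝓝 (b x))) :
    WeightedTVTendsto (growthWeight κ α) (fun k => 𝓜.filter (us k)) (𝓜.filter b) := by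
  have hprob : ∀ c : H, IsProbabilityMeasure (𝓜.filter c) := fun c =>
    hA.isProbabilityMeasure_filter (hy c)
  have hobs := hA.tendsto_obsDensity h
  have hi : ∀ c : H, Integrable (fun x => 𝓜.jointDensity c x / 𝓜.obsDensity c) := fun c =>
    (hA.integrable_jointDensity c).div_const _
  have hone : ∀ c : H, ∫ x, 𝓜.jointDensity c x / 𝓜.obsDensity c = 1 := fun c => by
    rw [integral_div]
    exact div_self (hy c).ne'
  have hnn : ∀ (c : H) x, 0 ≤ 𝓜.jointDensity c x / 𝓜.obsDensity c := fun c x =>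
    div_nonneg (jointDensity_nonneg _ _ _) (hy c).le
  have hL1 := tendsto_integral_abs_sub_of_tendsto (fun k => hi (us k)) (hi b)
    (fun k => hnn (us k)) (hnn b)
    (fun x => ((tendsto_pathDensity hA.a_isUnit h x).mul_const _).div hobs (hy b).ne') (by
      simp_rw [hone]
      exact tendsto_const_nhds)
  have hTV : WeightedTVTendsto (fun _ => 1) (fun k => 𝓜.filter (us k)) (𝓜.filter b) :=
    WeightedTVTendsto.of_tendsto_density
      (fun k => measurable_filterDensity 𝓜 (hA.measurable_coe (us k)))
      (measurable_filterDensity 𝓜 (hA.measurable_coe b)) (fun k => hi (us k)) (hi b)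
      (fun k => hnn (us k)) (hnn b) hL1
  obtain ⟨q, hq⟩ := exists_nat_gt (2 * max κ 1 + α)
  obtain ⟨M, hM⟩ := hA.exists_filter_moment_bound hf₀ r q
  refine weightedTVTendsto_growthWeight hTV hq hA.α_nonneg
    (C := |M| / (𝓜.obsDensity b / 2)) ?_
  filter_upwards [hobs.eventually (lt_mem_nhds (half_lt_self (hy b)))] with k hk
  simp_rw [Real.rpow_natCast]
  refine (hM (us k) (hr k) (hy _)).trans (ENNReal.ofReal_le_ofReal ?_)
  have hb2 : 0 < 𝓜.obsDensity b / 2 := half_pos (hy b)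
  calc M / 𝓜.obsDensity (us k) ≤ |M| / 𝓜.obsDensity (us k) :=
        div_le_div_of_nonneg_right (le_abs_self M) (hy _).le
    _ ≤ _ := div_le_div_of_nonneg_left (abs_nonneg M) hb2 hk.le

end RKHS

end EMDrift

namespace EMDrift

open ObservedDiffusion InformationTheory

/-! ### The risk and its minimizer -/

/-- For functions that are almost everywhere finite and integrable, the extended integral is the
Bochner integral. -/
theorem extIntegral_of_integrable {Ω : Type*} [MeasurableSpace Ω] {μ : Measure Ω} {g : Ω → EReal}
    {h : Ω → ℝ} (hh : Integrable h μ) (hgh : ∀ᵐ x ∂μ, g x = (h x : EReal)) :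
    extIntegral μ g = ((∫ x, h x ∂μ : ℝ) : EReal) := by
  have hp : ∀ {f : Ω → ℝ}, Integrable f μ → ∫⁻ x, ENNReal.ofReal (f x) ∂μ ≠ ∞ := fun hf =>
    hf.lintegral_lt_top.ne
  have e1 : ∫⁻ x, (g x).toENNReal ∂μ = ∫⁻ x, ENNReal.ofReal (h x) ∂μ := by
    refine lintegral_congr_ae ?_
    filter_upwards [hgh] with x hx
    rw [hx, EReal.real_coe_toENNReal]
  have e2 : ∫⁻ x, (-g x).toENNReal ∂μ = ∫⁻ x, ENNReal.ofReal (-h x) ∂μ := by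
    refine lintegral_congr_ae ?_
    filter_upwards [hgh] with x hx
    rw [hx, ← EReal.coe_neg, EReal.real_coe_toENNReal]
  rw [extIntegral, e1, e2, integral_eq_lintegral_pos_part_sub_lintegral_neg_part hh, EReal.coe_sub,
    EReal.coe_ennreal_toReal (hp hh), EReal.coe_ennreal_toReal (hp (f := fun x => -h x) hh.neg)]

theorem abs_entry_le_l2_opNorm {d : ℕ} (A : Matrix (Fin d) (Fin d) ℝ) (i j : Fin d) :
    |A i j| ≤ ‖A‖ := by
  have h := A.l2_opNorm_mulVec (EuclideanSpace.single j (1 : ℝ))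
  rw [PiLp.norm_single, norm_one, mul_one] at h
  refine le_trans ?_ h
  have h2 := PiLp.norm_apply_le
    (WithLp.toLp 2 (A *ᵥ (EuclideanSpace.single j (1 : ℝ)).ofLp) : Euc d) i
  simpa using h2

theorem abs_det_le_l2_opNorm {d : ℕ} (A : Matrix (Fin d) (Fin d) ℝ) :
    |A.det| ≤ d.factorial * ‖A‖ ^ d := by
  simpa using Matrix.det_le (abv := AbsoluteValue.abs) (A := A) (abs_entry_le_l2_opNorm A)

section RKHS

variable {d d₀ N₀ M₀ : ℕ} {𝓜 : ObservedDiffusion d d₀ N₀ M₀}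
variable {H : Type*} [NormedAddCommGroup H] [InnerProductSpace ℝ H] [CompleteSpace H]
  [RKHS ℝ H (Euc d) (Euc d)]
variable {Cσ Ca CK B s α κ : ℝ}

/-- The normalizing factor of a Gaussian step grows at most polynomially. -/
theorem ModelAssumption.exists_normalization_le
    (hA : ModelAssumption (H := H) 𝓜 Cσ Ca CK B s α κ) :
    ∃ (C : ℝ) (j : ℕ), ∀ u : Euc d,
      (√((2 * Real.pi) ^ d * (𝓜.Δ • 𝓜.a u).det))⁻¹ ≤ C * (1 + ‖u‖) ^ j := by
  obtain ⟨j, hj⟩ := exists_nat_ge α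
  have hΔ := 𝓜.Δ_pos
  have hCa := hA.Ca_nonneg
  set c : ℝ := ((2 * Real.pi) ^ d * 𝓜.Δ ^ d)⁻¹ with hc
  have hc0 : 0 < c := by positivity
  set F : ℝ := c * (d.factorial * (2 * Ca) ^ d) with hF
  have hF0 : 0 ≤ F := by positivity
  refine ⟨1 + F, j * d, fun u => ?_⟩
  have hdet : IsUnit (𝓜.a u).det := (Matrix.isUnit_iff_isUnit_det _).1 (hA.a_isUnit u)
  have e1 : ((2 * Real.pi) ^ d * (𝓜.Δ • 𝓜.a u).det)⁻¹ = c * ((𝓜.a u)⁻¹).det := by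
    rw [Matrix.det_smul, Fintype.card_fin, Matrix.det_nonsing_inv, Ring.inverse_eq_inv', hc,
      ← mul_assoc, mul_inv]
  have hone : (1 : ℝ) ≤ (1 + ‖u‖) ^ (j * d) := one_le_pow₀ (by linarith [norm_nonneg u])
  -- the determinant of `a⁻¹` is bounded by its norm, hence grows polynomially
  have h1 : ((𝓜.a u)⁻¹).det ≤ d.factorial * (2 * Ca) ^ d * (1 + ‖u‖) ^ (j * d) := by
    have h2 : ‖(𝓜.a u)⁻¹‖ ≤ 2 * Ca * (1 + ‖u‖) ^ j := by
      refine (hA.a_inv_bound u).trans ?_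
      have h3 := one_add_rpow_le (norm_nonneg u) hA.α_nonneg
      have h4 := rpow_le_pow_of_le (norm_nonneg u) hj
      calc Ca * (1 + ‖u‖ ^ α) ≤ Ca * (2 * (1 + ‖u‖) ^ j) := by gcongr; linarith
        _ = _ := by ring
    refine (le_abs_self _).trans ((abs_det_le_l2_opNorm _).trans ?_)
    rw [pow_mul, mul_assoc, ← mul_pow]
    gcongr
  have h5 : c * ((𝓜.a u)⁻¹).det ≤ F * (1 + ‖u‖) ^ (j * d) := by
    rw [hF, mul_assoc]
    gcongr
  rw [← Real.sqrt_inv, e1]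
  -- `√t ≤ 1 + t`
  refine Real.sqrt_le_iff.2 ⟨by positivity, ?_⟩
  have h6 : 0 ≤ F * (1 + ‖u‖) ^ (j * d) := by positivity
  nlinarith

/-- The density of the trajectory grows at most polynomially. -/
theorem ModelAssumption.exists_pathDensity_le
    (hA : ModelAssumption (H := H) 𝓜 Cσ Ca CK B s α κ) (hf₀ : ∃ C : ℝ, ∀ x, 𝓜.f₀ x ≤ C) :
    ∃ (C : ℝ) (j : ℕ), 1 ≤ C ∧ ∀ (b : Euc d → Euc d) (x : Path d N₀),
      𝓜.pathDensity b x ≤ C * (1 + ‖x‖) ^ j := by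
  obtain ⟨C₀, hC₀⟩ := hf₀
  obtain ⟨C₁, j, hC₁⟩ := hA.exists_normalization_le
  refine ⟨max 1 (C₀ * C₁ ^ N₀), j * N₀, le_max_left _ _, fun b x => ?_⟩
  have hC₁0 : 0 ≤ C₁ := by
    have h := (inv_nonneg.2 (Real.sqrt_nonneg _)).trans (hC₁ 0)
    simpa using h
  have hC₀0 : 0 ≤ C₀ := (𝓜.f₀_nonneg 0).trans (hC₀ 0)
  set Z : Euc d → ℝ := fun u => (√((2 * Real.pi) ^ d * (𝓜.Δ • 𝓜.a u).det))⁻¹ with hZ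
  have hZ0 : ∀ u, 0 ≤ Z u := fun u => inv_nonneg.2 (Real.sqrt_nonneg _)
  have hZx : ∀ n : Fin N₀, Z (x n.castSucc) ≤ C₁ * (1 + ‖x‖) ^ j := fun n => by
    refine (hC₁ (x n.castSucc)).trans ?_
    gcongr
    exact norm_le_pi_norm x n.castSucc
  have hP : ∏ n : Fin N₀, Z (x n.castSucc) ≤ (C₁ * (1 + ‖x‖) ^ j) ^ N₀ := by
    have h1 := Finset.prod_le_prod (s := Finset.univ) (fun n _ => hZ0 (x (Fin.castSucc n)))
      (fun n _ => hZx n)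
    rwa [Finset.prod_const, Finset.card_univ, Fintype.card_fin] at h1
  have hP0 : 0 ≤ ∏ n : Fin N₀, Z (x n.castSucc) := Finset.prod_nonneg fun n _ => hZ0 _
  have hexp : Real.exp (-𝓜.energy b x) ≤ 1 :=
    Real.exp_le_one_iff.2 (neg_nonpos.2 (energy_nonneg _ _))
  have heq : 𝓜.pathDensity b x
      = 𝓜.f₀ (x 0) * (∏ n : Fin N₀, Z (x n.castSucc)) * Real.exp (-𝓜.energy b x) :=
    pathDensity_eq hA.a_isUnit b x
  rw [heq]
  generalize (∏ n : Fin N₀, Z (x n.castSucc)) = P at hP hP0 ⊢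
  have hf := hC₀ (x 0)
  calc 𝓜.f₀ (x 0) * P * Real.exp (-𝓜.energy b x)
      ≤ (C₀ * (C₁ * (1 + ‖x‖) ^ j) ^ N₀) * 1 := by gcongr
    _ = C₀ * C₁ ^ N₀ * (1 + ‖x‖) ^ (j * N₀) := by rw [mul_pow, ← pow_mul]; ring
    _ ≤ max 1 (C₀ * C₁ ^ N₀) * (1 + ‖x‖) ^ (j * N₀) := by gcongr; exact le_max_right _ _

/-- The negative log-density of the trajectory has an exponential moment under the filtering
distribution, because the square root of the density is integrable. -/
theorem ModelAssumption.lintegral_exp_neg_log_lt_top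
    (hA : ModelAssumption (H := H) 𝓜 Cσ Ca CK B s α κ)
    (hf₀ : ∀ q : ℝ, 0 < q → ∫⁻ x, ENNReal.ofReal (‖x‖ ^ q * 𝓜.f₀ x) < ∞) {b : H}
    (hb : 0 < 𝓜.obsDensity b) :
    ∫⁻ x, ENNReal.ofReal (Real.exp (-(Real.log (𝓜.pathDensity b x) / 2))) ∂𝓜.filter b < ∞ := by
  -- with `P = (1 + ‖x‖) ^ q`, the bound `√f ≤ P * f + P⁻¹` is integrable: `P` is a moment of the
  -- trajectory, and `P⁻¹` is integrable because `q` exceeds the dimension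
  set q := Module.finrank ℝ (Path d N₀) + 1 with hq
  obtain ⟨M, hM⟩ := hA.exists_moment_bound hf₀ ‖b‖ q
  have hB : 0 ≤ B ^ M₀ := pow_nonneg hA.B_nonneg _
  set K := B ^ M₀ / 𝓜.obsDensity b with hK
  have hK0 : 0 ≤ K := by positivity
  have hbm := 𝓜.measurable_pathDensity (hA.measurable_coe b)
  have hem : Measurable fun x =>
      ENNReal.ofReal (Real.exp (-(Real.log (𝓜.pathDensity b x) / 2))) :=
    (hbm.log.div_const 2).neg.exp.ennreal_ofReal
  have hw : Integrable (fun x : Path d N₀ => (1 + ‖x‖) ^ (-(q : ℝ))) :=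
    integrable_one_add_norm (by rw [hq]; push_cast; linarith)
  rw [ObservedDiffusion.filter, lintegral_withDensity_eq_lintegral_mul _
    (measurable_filterDensity 𝓜 (hA.measurable_coe b)).ennreal_ofReal hem]
  have hpt : ∀ x : Path d N₀, ENNReal.ofReal (𝓜.jointDensity b x / 𝓜.obsDensity b) *
      ENNReal.ofReal (Real.exp (-(Real.log (𝓜.pathDensity b x) / 2))) ≤
      ENNReal.ofReal K * (ENNReal.ofReal ((1 + ‖x‖) ^ q * 𝓜.pathDensity b x)
        + ENNReal.ofReal ((1 + ‖x‖) ^ (-(q : ℝ)))) := fun x => by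
    have hS : 0 < 1 + ‖x‖ := by positivity
    have hf := 𝓜.pathDensity_nonneg b x
    rw [← ENNReal.ofReal_mul (div_nonneg (jointDensity_nonneg _ _ _) hb.le),
      ← ENNReal.ofReal_add (by positivity) (by positivity), ← ENNReal.ofReal_mul hK0]
    refine ENNReal.ofReal_le_ofReal ?_
    rw [Real.rpow_neg hS.le, Real.rpow_natCast]
    set f := 𝓜.pathDensity b x
    set P := (1 + ‖x‖) ^ q with hP
    have hP0 : 0 < P := by positivity
    rcases hf.eq_or_lt with h0 | h0
    · rw [jointDensity, show 𝓜.pathDensity b x = 0 from h0.symm, zero_mul, zero_div, zero_mul]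
      positivity
    · have h1 : f * Real.exp (-(Real.log f / 2)) = √f := by
        rw [Real.sqrt_eq_rpow, Real.rpow_def_of_pos h0]
        nth_rewrite 1 [← Real.exp_log h0]
        rw [← Real.exp_add]
        ring_nf
      have h2 : √f ≤ P * f + P⁻¹ := by
        refine Real.sqrt_le_iff.2 ⟨by positivity, ?_⟩
        have h3 : P * f * P⁻¹ = f := by field_simp
        nlinarith [mul_pos hP0 h0, inv_pos.2 hP0]
      have h4 : 𝓜.jointDensity b x / 𝓜.obsDensity b ≤ K * f := by
        rw [hK, div_mul_eq_mul_div]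
        exact div_le_div_of_nonneg_right (hA.jointDensity_le b x) hb.le
      calc 𝓜.jointDensity b x / 𝓜.obsDensity b * Real.exp (-(Real.log f / 2))
          ≤ K * f * Real.exp (-(Real.log f / 2)) := by gcongr
        _ = K * √f := by rw [mul_assoc, h1]
        _ ≤ _ := by gcongr
  refine lt_of_le_of_lt (lintegral_mono hpt) ?_
  rw [lintegral_const_mul' _ _ ENNReal.ofReal_ne_top, lintegral_add_right _ (by fun_prop)]
  exact ENNReal.mul_lt_top ENNReal.ofReal_lt_top (ENNReal.add_lt_top.2
    ⟨(hM b le_rfl).trans_lt ENNReal.ofReal_lt_top, hw.lintegral_lt_top⟩)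

theorem ae_pathDensity_pos {b : H} (hA : ModelAssumption (H := H) 𝓜 Cσ Ca CK B s α κ)
    {μ : Measure (Path d N₀)} (hμ : μ ≪ 𝓜.filter b) : ∀ᵐ x ∂μ, 0 < 𝓜.pathDensity b x := by
  refine hμ.ae_le ?_
  change ∀ᵐ x ∂𝓜.filter b, 0 < 𝓜.pathDensity b x
  rw [ObservedDiffusion.filter, ae_withDensity_iff
    (measurable_filterDensity 𝓜 (hA.measurable_coe b)).ennreal_ofReal]
  refine Eventually.of_forall fun x hx => (𝓜.pathDensity_nonneg b x).lt_of_ne fun h0 => hx ?_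
  rw [jointDensity, ← h0, zero_mul, zero_div, ENNReal.ofReal_zero]

theorem ModelAssumption.integrable_log_pathDensity
    (hA : ModelAssumption (H := H) 𝓜 Cσ Ca CK B s α κ) (hf₀_bdd : ∃ C : ℝ, ∀ x, 𝓜.f₀ x ≤ C)
    (hf₀ : ∀ q : ℝ, 0 < q → ∫⁻ x, ENNReal.ofReal (‖x‖ ^ q * 𝓜.f₀ x) < ∞) {b : H}
    (hb : 0 < 𝓜.obsDensity b) {μ : Measure (Path d N₀)} [IsProbabilityMeasure μ]
    (hkl : klDiv μ (𝓜.filter b) ≠ ∞) (hμ : Integrable (growthWeight κ α) μ) :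
    Integrable (fun x => Real.log (𝓜.pathDensity b x)) μ := by
  have := hA.isProbabilityMeasure_filter hb
  have hbm := 𝓜.measurable_pathDensity (hA.measurable_coe b)
  have hneg := lintegral_ofReal_lt_top_of_klDiv_ne_top hkl ((hbm.log.div_const 2).neg)
    (hA.lintegral_exp_neg_log_lt_top hf₀ hb)
  obtain ⟨C, j, hC1, hC⟩ := hA.exists_pathDensity_le hf₀_bdd
  -- the negative part of the logarithm, halved
  have hnegi : Integrable (fun x => max (-(Real.log (𝓜.pathDensity b x) / 2)) 0) μ := by
    refine (lintegral_ofReal_ne_top_iff_integrable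
      ((hbm.log.div_const 2).neg.max (measurable_const (a := (0 : ℝ)))).aestronglyMeasurable
      (Eventually.of_forall fun x => le_max_right _ _)).1 ?_
    refine ne_top_of_le_ne_top hneg.ne (lintegral_mono fun x => ?_)
    exact (ENNReal.ofReal_max _ _).trans_le (by simp)
  refine ((hμ.const_mul (C + j)).add (hnegi.const_mul 2)).mono' hbm.log.aestronglyMeasurable ?_
  filter_upwards [ae_pathDensity_pos hA (klDiv_ne_top_iff.1 hkl).1] with x hx
  have hS : 0 < 1 + ‖x‖ := by positivity
  have hG : 1 + ‖x‖ ≤ growthWeight κ α x := by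
    have h1 : (1 : ℝ) ≤ 2 * max κ 1 + α := by linarith [le_max_right κ 1, hA.α_nonneg]
    calc 1 + ‖x‖ = (1 + ‖x‖) ^ (1 : ℝ) := (Real.rpow_one _).symm
      _ ≤ _ := Real.rpow_le_rpow_of_exponent_le (by linarith [norm_nonneg x]) h1
  -- the positive part is controlled by the polynomial growth of the density
  have hup : Real.log (𝓜.pathDensity b x) ≤ (C + j) * growthWeight κ α x := by
    have h1 := Real.log_le_log hx (hC b x)
    rw [Real.log_mul (by linarith) (by positivity), Real.log_pow] at h1
    have h2 := Real.log_le_sub_one_of_pos (zero_lt_one.trans_le hC1)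
    have h3 := Real.log_le_sub_one_of_pos hS
    have h4 : (j : ℝ) * Real.log (1 + ‖x‖) ≤ j * (1 + ‖x‖) := by gcongr; linarith
    have h5 : C ≤ C * (1 + ‖x‖) := le_mul_of_one_le_right (by linarith) (by linarith [norm_nonneg x])
    calc Real.log (𝓜.pathDensity b x) ≤ (C + j) * (1 + ‖x‖) := by linarith
      _ ≤ _ := by gcongr
  simp only [Pi.add_apply]
  have h0 : 0 ≤ (C + j) * growthWeight κ α x := by
    have := growthWeight_nonneg κ α x
    positivity
  have h6 := le_max_left (-(Real.log (𝓜.pathDensity b x) / 2)) 0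
  have h7 := le_max_right (-(Real.log (𝓜.pathDensity b x) / 2)) 0
  rw [Real.norm_eq_abs, abs_le]
  constructor <;> linarith

/-- Up to a constant, the risk is the integral of the energy plus the penalty; in particular it is
finite for measures of finite relative entropy with respect to a filtering distribution. -/
theorem ModelAssumption.exists_risk_eq
    (hA : ModelAssumption (H := H) 𝓜 Cσ Ca CK B s α κ) (hf₀_bdd : ∃ C : ℝ, ∀ x, 𝓜.f₀ x ≤ C)
    (hf₀ : ∀ q : ℝ, 0 < q → ∫⁻ x, ENNReal.ofReal (‖x‖ ^ q * 𝓜.f₀ x) < ∞) {b₁ : H}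
    (hb₁ : 0 < 𝓜.obsDensity b₁) {μ : Measure (Path d N₀)} [IsProbabilityMeasure μ]
    (hkl : klDiv μ (𝓜.filter b₁) ≠ ∞) (hμ : Integrable (growthWeight κ α) μ) (lam : ℝ) :
    ∃ c : ℝ, ∀ b : H, risk 𝓜 lam b μ
      = ((c + (∫ x, 𝓜.energy b x ∂μ + lam * ‖b‖ ^ 2) : ℝ) : EReal) := by
  have hlog := hA.integrable_log_pathDensity hf₀_bdd hf₀ hb₁ hkl hμ
  have hE := hA.integrable_energy hμ
  refine ⟨-∫ x, Real.log (𝓜.pathDensity b₁ x) ∂μ - ∫ x, 𝓜.energy b₁ x ∂μ, fun b => ?_⟩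
  have hi : Integrable (fun x => -Real.log (𝓜.pathDensity b₁ x)
      - 𝓜.energy b₁ x + 𝓜.energy b x) μ := (hlog.neg.sub (hE b₁)).add (hE b)
  have hae : ∀ᵐ x ∂μ, -ENNReal.log (ENNReal.ofReal (𝓜.pathDensity b x))
      = ((-Real.log (𝓜.pathDensity b₁ x) - 𝓜.energy b₁ x + 𝓜.energy b x : ℝ) : EReal) := by
    filter_upwards [ae_pathDensity_pos hA (klDiv_ne_top_iff.1 hkl).1] with x hx
    have hpos : 0 < 𝓜.pathDensity b x := by
      rw [pathDensity_eq_mul_exp hA.a_isUnit b₁ b]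
      positivity
    rw [ENNReal.log_ofReal_of_pos hpos, ← EReal.coe_neg, pathDensity_eq_mul_exp hA.a_isUnit b₁ b,
      Real.log_mul hx.ne' (Real.exp_ne_zero _), Real.log_exp]
    congr 1
    ring
  rw [risk, extIntegral_of_integrable hi hae, ← EReal.coe_add]
  congr 1
  have i1 : Integrable (fun x => -Real.log (𝓜.pathDensity b₁ x) - 𝓜.energy b₁ x) μ :=
    hlog.neg.sub (hE b₁)
  have i2 : Integrable (fun x => -Real.log (𝓜.pathDensity b₁ x)) μ := hlog.neg
  rw [integral_add i1 (hE b), integral_sub i2 (hE b₁), integral_neg]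
  ring

/-- A solution of the Euler-Lagrange equation is the unique minimizer of the risk. -/
theorem ModelAssumption.isMStep_of_isCritical
    (hA : ModelAssumption (H := H) 𝓜 Cσ Ca CK B s α κ) (hf₀_bdd : ∃ C : ℝ, ∀ x, 𝓜.f₀ x ≤ C)
    (hf₀ : ∀ q : ℝ, 0 < q → ∫⁻ x, ENNReal.ofReal (‖x‖ ^ q * 𝓜.f₀ x) < ∞) {b₁ : H}
    (hb₁ : 0 < 𝓜.obsDensity b₁) {μ : Measure (Path d N₀)} [IsProbabilityMeasure μ]
    (hkl : klDiv μ (𝓜.filter b₁) ≠ ∞) (hμ : Integrable (growthWeight κ α) μ) {lam : ℝ}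
    (hlam : 0 < lam) {v : H} (hv : IsCritical 𝓜 lam μ v) : IsMStep 𝓜 lam μ v := by
  intro b' hb'
  obtain ⟨c, hc⟩ := hA.exists_risk_eq hf₀_bdd hf₀ hb₁ hkl hμ lam
  rw [hc, hc, EReal.coe_lt_coe_iff]
  have h1 := hA.integral_energy_add_le hμ hv b'
  have h2 : 0 < lam * ‖b' - v‖ ^ 2 := by
    have : 0 < ‖b' - v‖ := norm_pos_iff.2 (sub_ne_zero.2 hb')
    positivity
  linarith

/-- A bound on the moments of the marginals bounds the moments of the norm of the trajectory. -/
theorem lintegral_one_add_norm_rpow_le {p C : ℝ} (hp : 0 < p) {μ : ProbabilityMeasure (Path d N₀)}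
    (hμ : μ ∈ momentClass d N₀ p C) :
    ∫⁻ x, ENNReal.ofReal ((1 + ‖x‖) ^ p) ∂(μ : Measure (Path d N₀))
      ≤ ENNReal.ofReal (2 ^ p * (1 + (N₀ + 1) * |C|)) := by
  have hpt : ∀ x : Path d N₀, ENNReal.ofReal ((1 + ‖x‖) ^ p) ≤
      ENNReal.ofReal (2 ^ p) * (1 + ∑ n, ENNReal.ofReal (‖x n‖ ^ p)) := fun x => by
    obtain ⟨n, hn⟩ := Finite.exists_max fun n => ‖x n‖
    have hx : ‖x‖ ≤ ‖x n‖ := (pi_norm_le_iff_of_nonneg (norm_nonneg _)).2 hn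
    have h1 : (1 + ‖x‖) ^ p ≤ 2 ^ p * (1 + ‖x n‖ ^ p) := by
      have hm : 0 ≤ max 1 ‖x n‖ := zero_le_one.trans (le_max_left _ _)
      calc (1 + ‖x‖) ^ p ≤ (2 * max 1 ‖x n‖) ^ p := by
            gcongr
            linarith [le_max_left 1 ‖x n‖, le_max_right 1 ‖x n‖]
        _ = 2 ^ p * max 1 ‖x n‖ ^ p := Real.mul_rpow zero_le_two hm
        _ ≤ _ := by
            gcongr
            rcases max_choice 1 ‖x n‖ with h | h
            · rw [h, Real.one_rpow]
              linarith [Real.rpow_nonneg (norm_nonneg (x n)) p]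
            · rw [h]
              linarith
    refine (ENNReal.ofReal_le_ofReal h1).trans ?_
    rw [ENNReal.ofReal_mul (by positivity), ENNReal.ofReal_add zero_le_one (by positivity),
      ENNReal.ofReal_one]
    gcongr
    exact Finset.single_le_sum (f := fun n => ENNReal.ofReal (‖x n‖ ^ p)) (fun _ _ => zero_le)
      (Finset.mem_univ n)
  refine (lintegral_mono hpt).trans ?_
  rw [lintegral_const_mul' _ _ ENNReal.ofReal_ne_top, lintegral_add_left measurable_const,
    lintegral_const, measure_univ, mul_one, lintegral_finsetSum _ (fun n _ => by fun_prop),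
    ENNReal.ofReal_mul (by positivity), ENNReal.ofReal_add zero_le_one (by positivity),
    ENNReal.ofReal_one]
  gcongr
  refine (Finset.sum_le_card_nsmul _ _ (ENNReal.ofReal |C|) fun n _ =>
    (hμ n).trans (ENNReal.ofReal_le_ofReal (le_abs_self C))).trans_eq ?_
  rw [Finset.card_univ, Fintype.card_fin, nsmul_eq_mul, ENNReal.ofReal_mul (by positivity)]
  congr 1
  rw [← Nat.cast_succ, ENNReal.ofReal_natCast]

end RKHS

end EMDrift

/-! ### Convergence of the approximate EM iteration -/

theorem mainTheorem1 {d d₀ N₀ M₀ : ℕ} (𝓜 : EMDrift.ObservedDiffusion d d₀ N₀ M₀)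
    {H : Type*} [NormedAddCommGroup H] [InnerProductSpace ℝ H] [CompleteSpace H]
    [RKHS ℝ H (EMDrift.Euc d) (EMDrift.Euc d)]
    (lam : ℝ) (hlam : 0 < lam)
    (Cσ Ca CK B s α κ : ℝ)
    (hA : EMDrift.ModelAssumption (H := H) 𝓜 Cσ Ca CK B s α κ)
    -- the initial density is bounded and has all moments
    (hf₀_bdd : ∃ C : ℝ, ∀ x, 𝓜.f₀ x ≤ C)
    (hf₀_mom : ∀ q : ℝ, 0 < q → ∫⁻ x, ENNReal.ofReal (‖x‖ ^ q * 𝓜.f₀ x) < ∞)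
    -- the log-likelihood of the data is finite
    (hy : ∀ b : H, 0 < 𝓜.obsDensity b)
    -- the approximations of the filtering distributions
    (approx : H → ℕ → ProbabilityMeasure (EMDrift.Path d N₀))
    (happrox_KL : ∀ b : H, Tendsto
      (fun L => InformationTheory.klDiv (approx b L : Measure (EMDrift.Path d N₀)) (𝓜.filter b))
      atTop (𝓝 0))
    (happrox_mom : ∀ b : H, ∃ p C : ℝ, 2 * max κ 1 + α < p ∧
      ∀ L, 1 ≤ L → approx b L ∈ EMDrift.momentClass d N₀ p C)
    (b₀ : H) :
    ∃ (L : ℕ → ℕ) (bhat : ℕ → H), (∀ k, 0 < L k) ∧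
      EMDrift.IsApproxEMSeq 𝓜 lam approx L b₀ bhat ∧
      ∃ ℓ : ℝ,
        Tendsto (fun k => EMDrift.loss 𝓜 lam (bhat k)) atTop (𝓝 ℓ) ∧
        IsCompact (closure (range bhat)) ∧
        EMDrift.limitSet bhat ⊆ EMDrift.stationarySet 𝓜 H lam ∧
        EMDrift.limitSet bhat ⊆ {b | EMDrift.loss 𝓜 lam b = ℓ} ∧
        IsConnected (EMDrift.limitSet bhat) := by
  have hprob : ∀ b : H, IsProbabilityMeasure (𝓜.filter b) := fun b =>
    hA.isProbabilityMeasure_filter (hy b)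
  have hG : ∀ b : H, Integrable (EMDrift.growthWeight κ α) (𝓜.filter b) := fun b =>
    hA.integrable_growthWeight_filter hf₀_mom (hy b)
  choose Ψ hΨ using fun b : H => hA.exists_isCritical (hG b) hlam
  -- along bounded pointwise convergent sequences of drifts, the exact M-steps converge in norm
  have hΨlim : ∀ (u : ℕ → H) (b : H) (r : ℝ), (∀ n, ‖u n‖ ≤ r) →
      (∀ x, Tendsto (fun n => u n x) atTop (𝓝 (b x))) →
      Tendsto (fun n => Ψ (u n)) atTop (𝓝 (Ψ b)) := fun u b r hr hu =>
    hA.tendsto_of_isCritical hlam (hG b) (Eventually.of_forall fun n => hG (u n))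
      (hA.weightedTVTendsto_filter hf₀_mom hy hr hu) (hΨ b) (Eventually.of_forall fun n => hΨ (u n))
  have heval : ∀ {u : ℕ → H} {b : H}, Tendsto u atTop (𝓝 b) →
      ∀ x, Tendsto (fun n => u n x) atTop (𝓝 (b x)) := fun hu x =>
    ((RKHS.continuous_eval x).tendsto _).comp hu
  have hΨcont : Continuous Ψ := by
    rw [continuous_iff_seqContinuous]
    intro u b hu
    obtain ⟨r, hr⟩ := hu.norm.bddAbove_range
    exact hΨlim u b r (fun n => hr ⟨n, rfl⟩) (heval hu)
  have hloss : Continuous fun b : H => EMDrift.loss 𝓜 lam b := by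
    rw [continuous_iff_seqContinuous]
    intro u b hu
    have h1 := (Real.continuousAt_log (hy b).ne').tendsto.comp (hA.tendsto_obsDensity (heval hu))
    exact h1.neg.add ((hu.norm.pow 2).const_mul lam)
  have hdesc : ∀ b : H, EMDrift.loss 𝓜 lam (Ψ b)
      ≤ EMDrift.loss 𝓜 lam b - lam * ‖Ψ b - b‖ ^ 2 := fun b => by
    have h1 := hA.loss_sub_loss_le hf₀_mom lam (hy b) (hy (Ψ b))
    have h2 := hA.integral_energy_add_le (hG b) (hΨ b) b
    rw [norm_sub_rev] at h2
    linarith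
  have hcoer : ∃ c, ∀ b : H, lam * ‖b‖ ^ 2 - c ≤ EMDrift.loss 𝓜 lam b :=
    ⟨Real.log (B ^ M₀), fun b => by
      have h1 := Real.log_le_log (hy b) (hA.obsDensity_le b)
      unfold EMDrift.loss
      linarith⟩
  have happ : ∀ b : H, ∀ ε > 0, ∃ L, 0 < L ∧ ∃ b' : H,
      EMDrift.IsMStep 𝓜 lam (approx b L : Measure (EMDrift.Path d N₀)) b' ∧
        ‖b' - Ψ b‖ < ε := by
    intro b ε hε
    obtain ⟨p, C, hp, hmem⟩ := happrox_mom b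
    have hp0 : 0 < p := by linarith [le_max_right κ 1, hA.α_nonneg]
    have hmom : ∀ᶠ L in atTop, ∫⁻ x, ENNReal.ofReal ((1 + ‖x‖) ^ p)
        ∂(approx b L : Measure (EMDrift.Path d N₀))
        ≤ ENNReal.ofReal (2 ^ p * (1 + (N₀ + 1) * |C|)) := by
      filter_upwards [eventually_ge_atTop 1] with L hL
      exact EMDrift.lintegral_one_add_norm_rpow_le hp0 (hmem L hL)
    have hint : ∀ᶠ L in atTop, Integrable (EMDrift.growthWeight κ α)
        (approx b L : Measure (EMDrift.Path d N₀)) := by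
      filter_upwards [hmom] with L hL
      exact EMDrift.integrable_growthWeight_of_lintegral_lt_top hp.le
        (hL.trans_lt ENNReal.ofReal_lt_top)
    have hTV := EMDrift.weightedTVTendsto_growthWeight
      (EMDrift.WeightedTVTendsto.of_klDiv (happrox_KL b)) hp hA.α_nonneg hmom
    -- an arbitrary value is taken for the finitely many `L` for which the weight may fail to be
    -- integrable
    have hex : ∀ L, ∃ v : H, Integrable (EMDrift.growthWeight κ α)
        (approx b L : Measure (EMDrift.Path d N₀)) →
        EMDrift.IsCritical 𝓜 lam (approx b L : Measure (EMDrift.Path d N₀)) v := fun L => by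
      by_cases h : Integrable (EMDrift.growthWeight κ α)
        (approx b L : Measure (EMDrift.Path d N₀))
      · obtain ⟨v, hv⟩ := hA.exists_isCritical h hlam
        exact ⟨v, fun _ => hv⟩
      · exact ⟨0, fun h' => absurd h' h⟩
    choose vs hvs using hex
    have hlim := hA.tendsto_of_isCritical hlam (hG b) hint hTV (hΨ b)
      (hint.mono fun L hL => hvs L hL)
    have hfin : ∀ᶠ L in atTop, InformationTheory.klDiv
        (approx b L : Measure (EMDrift.Path d N₀)) (𝓜.filter b) < ∞ :=
      (happrox_KL b).eventually (gt_mem_nhds ENNReal.zero_lt_top)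
    have hclose := Metric.tendsto_nhds.1 hlim ε hε
    obtain ⟨L, hL1, hLi, hLf, hLc⟩ :=
      ((eventually_ge_atTop 1).and (hint.and (hfin.and hclose))).exists
    rw [dist_eq_norm] at hLc
    exact ⟨L, hL1, vs L, hA.isMStep_of_isCritical hf₀_bdd hf₀_mom (hy b) hLf.ne hLi hlam
      (hvs L hLi), hLc⟩
  obtain ⟨L, bhat, hL, hseq, ℓ, hℓ, hcpt, hstat, hlev, hconn⟩ :=
    EMDrift.exists_approx_iteration hlam hdesc hcoer hloss hΨcont (fun r u hu => by
      obtain ⟨b, φ, hφ, hb⟩ := hA.exists_subseq_tendsto hu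
      exact ⟨Ψ b, φ, hφ, hΨlim _ b r (fun n => hu _) hb⟩) happ b₀
  refine ⟨L, bhat, hL, hseq, ℓ, hℓ, hcpt, fun b hb => ?_, hlev, hconn⟩
  have hfix : Ψ b = b := hstat hb
  have hcrit := hΨ b
  rw [hfix] at hcrit
  refine hA.isMStep_of_isCritical hf₀_bdd hf₀_mom (hy b) ?_ (hG b) hlam hcrit
  rw [InformationTheory.klDiv_self]
  exact ENNReal.zero_ne_top
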